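/- Let $\mathtt L$ be a many-sorted first-order language, let $\kappa>2^{\aleph_0}$ be a cardinal, and let $\mathfrak M$ be a $\kappa$-saturated $\mathtt L$-structure. "Definable" means definable in $\mathfrak M$ with parameters from $\mathfrak M$; a set is "type-definable" if it is an intersection of fewer than $\kappa$ definable sets; an index is "bounded" if it is less than $\kappa$. A subset $X$ of a group is "symmetric" if $1\in X=X^{-1}$; $XY$ denotes the set of products and $X^m=X\cdots X$ ($m$ factors). Let $G$ be a definable group in $\mathfrak M$ and $A\subseteq G$ a definable symmetric subset. Let $T=(T_i)_{i\in\mathbb N}$ be a sequence of definable symmetric subsets of $G$ such that for all $i$ we have $T_{i+1}^2\subseteq T_i$ and $a^{-1}T_{i+1}a\subseteq T_i$ for every $a\in A$. Put $T_\infty=\bigcap_{i\in\mathbb N}T_i$. Suppose that $A$ is $T$-rough definably amenable, witnessed by $(\mu_i)_{i\in\mathbb N}$. That is, for every $i\in\mathbb N$, $\mu_i$ is a function from the definable subsets of $G$ to $[0,\infty]$ such that for all definable $X,Y,Z\subseteq G$ and all $g\in G$: (1) $\mu_i(X)\le\mu_i(Y)$ if $X\subseteq Y$, and $\mu_i(X\cup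 Y)\le\mu_i(X)+\mu_i(Y)$; (2) $\mu_i(Y\cup Z)=\mu_i(Y)+\mu_i(Z)$ if $Y\cap ZT_i=\emptyset$; (3) $\mu_i(gX)=\mu_i(X)$, and $\mu_i(A)=1$. Suppose moreover that for every $m\in\mathbb N$ there is $i_m\in\mathbb N$ such that $\mu_i(A^m)<\infty$ for all $i>i_m$. Then there is a type-definable normal subgroup $N$ of the subgroup $\langle AT_\infty\rangle$ of $G$ generated by $AT_\infty$, of bounded index in $\langle AT_\infty\rangle$, such that $T_\infty\subseteq N\subseteq A^4T_\infty$. -/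

import Mathlib

open scoped Pointwise ENNReal Cardinal

universe u v v' w

/-! ### Many-sorted first-order logic -/

/-- A many-sorted first-order language. Function symbols have a list of argument sorts and a value
sort (constants are function symbols without arguments), relation symbols have a list of argument
sorts. -/
structure MSLanguage where
  Sorts : Type u
  Functions : Type v
  funDom : Functions → List Sorts
  funCod : Functions → Sorts
  Relations : Type v'
  relDom : Relations → List Sorts

namespace MSLanguage

/-- An `L`-structure on a family `M` of sets, one for each sort. -/
class Structure (L : MSLanguage.{u, v, v'}) (M : L.Sorts → Type w) where
  funMap : ∀ f : L.Functions,
    (∀ k : Fin (L.funDom f).length, M ((L.funDom f).get k)) → M (L.funCod f)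
  RelMap : ∀ R : L.Relations,
    (∀ k : Fin (L.relDom R).length, M ((L.relDom R).get k)) → Prop

/-- Terms whose variables of sort `s` are the elements of `V s`, sorted by their value sort. -/
inductive Term (L : MSLanguage.{u, v, v'}) (V : L.Sorts → Type w) :
    L.Sorts → Type (max u v w)
  | var {s : L.Sorts} (x : V s) : Term L V s
  | func (f : L.Functions)
      (ts : ∀ k : Fin (L.funDom f).length, Term L V ((L.funDom f).get k)) :
      Term L V (L.funCod f)

/-- The family of variables `V` with one new variable of sort `s`. -/
def ExtVar {S : Type u} (V : S → Type w) (s : S) : S → Type w :=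
  fun s' => V s' ⊕ PLift (s = s')

/-- First-order formulas whose free variables of sort `s` are among the elements of `V s`. In
`all s φ` the new variable of `φ` is bound. -/
inductive Formula (L : MSLanguage.{u, v, v'}) :
    (L.Sorts → Type w) → Type (max u v v' (w + 1))
  | falsum {V : L.Sorts → Type w} : Formula L V
  | equal {V : L.Sorts → Type w} {s : L.Sorts} (t₁ t₂ : Term L V s) : Formula L V
  | rel {V : L.Sorts → Type w} (R : L.Relations)
      (ts : ∀ k : Fin (L.relDom R).length, Term L V ((L.relDom R).get k)) : Formula L V
  | imp {V : L.Sorts → Type w} (φ ψ : Formula L V) : Formula L V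
  | all {V : L.Sorts → Type w} (s : L.Sorts) (φ : Formula L (ExtVar V s)) : Formula L V

/-- Extend an assignment by the value `m` for the new variable. -/
def extAssign {S : Type u} {M : S → Type v} {V : S → Type w} {s : S}
    (e : ∀ s', V s' → M s') (m : M s) : ∀ s', ExtVar V s s' → M s'
  | s', Sum.inl x => e s' x
  | _, Sum.inr ⟨rfl⟩ => m

/-- The value of a term under an assignment. -/
def Term.realize {L : MSLanguage.{u, v, v'}} {M : L.Sorts → Type w} [L.Structure M]
    {V : L.Sorts → Type w} (e : ∀ s, V s → M s) : ∀ {s : L.Sorts}, L.Term V s → M s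
  | _, .var x => e _ x
  | _, .func f ts => Structure.funMap f (fun k => (ts k).realize e)

/-- Satisfaction of a formula under an assignment. -/
def Formula.Realize {L : MSLanguage.{u, v, v'}} {M : L.Sorts → Type w} [L.Structure M] :
    ∀ {V : L.Sorts → Type w}, L.Formula V → (∀ s, V s → M s) → Prop
  | _, .falsum, _ => False
  | _, .equal t₁ t₂, e => t₁.realize e = t₂.realize e
  | _, .rel R ts, e => Structure.RelMap R (fun k => (ts k).realize e)
  | _, .imp φ ψ, e => φ.Realize e → ψ.Realize e
  | _, .all s φ, e => ∀ m : M s, φ.Realize (extAssign e m)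

/-- Variables for formulas with parameters from `C` and free variables indexed by `ι`, the
`i`-th one of sort `σ i`. -/
abbrev ParamVar {S : Type u} {M : S → Type w} (C : ∀ s, Set (M s)) {ι : Type} (σ : ι → S) :
    S → Type w :=
  fun s => C s ⊕ {i : ι // σ i = s}

/-- Parameters stand for themselves, the `i`-th free variable for the `i`-th entry of `x`. -/
def paramAssign {S : Type u} {M : S → Type w} (C : ∀ s, Set (M s)) {ι : Type} {σ : ι → S}
    (x : ∀ i, M (σ i)) : ∀ s, ParamVar C σ s → M s
  | _, Sum.inl c => c.1
  | _, Sum.inr ⟨i, rfl⟩ => x i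

/-- `X` is definable in `M` by a formula with parameters in `M`. -/
def Definable (L : MSLanguage.{u, v, v'}) {M : L.Sorts → Type w} [L.Structure M]
    {ι : Type} {σ : ι → L.Sorts} (X : Set (∀ i, M (σ i))) : Prop :=
  ∃ φ : L.Formula (ParamVar (fun s => (Set.univ : Set (M s))) σ),
    ∀ x, x ∈ X ↔ φ.Realize (paramAssign _ x)

/-- `M` is `κ`-saturated: every finitely satisfiable set of formulas in finitely many free
variables over a set of fewer than `κ` parameters is satisfiable in `M`. -/
def IsSaturated (L : MSLanguage.{u, v, v'}) (M : L.Sorts → Type w) [L.Structure M]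
    (κ : Cardinal.{max u w}) : Prop :=
  ∀ C : ∀ s, Set (M s), #(Σ s, C s) < κ →
    ∀ (ι : Type) [Finite ι] (σ : ι → L.Sorts) (p : Set (L.Formula (ParamVar C σ))),
      (∀ q : Set (L.Formula (ParamVar C σ)), q ⊆ p → q.Finite →
        ∃ x : ∀ i, M (σ i), ∀ φ ∈ q, φ.Realize (paramAssign C x)) →
      ∃ x : ∀ i, M (σ i), ∀ φ ∈ p, φ.Realize (paramAssign C x)

/-- A group whose underlying set `G` is a definable set of finite tuples and whose multiplication
has a definable graph. -/
structure IsDefinableGroup (L : MSLanguage.{u, v, v'}) {M : L.Sorts → Type w} [L.Structure M]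
    {n : ℕ} {σ : Fin n → L.Sorts} (G : Set (∀ i, M (σ i))) [Group G] : Prop where
  definable_carrier : L.Definable G
  definable_mul : L.Definable (σ := fun p : Fin n × Fin 3 => σ p.1)
    {x : ∀ p : Fin n × Fin 3, M (σ p.1) | ∃ a b : G,
      (∀ i, x (i, 0) = a.1 i) ∧ (∀ i, x (i, 1) = b.1 i) ∧ (∀ i, x (i, 2) = (a * b).1 i)}

/-- The collection of definable subsets of `G`. -/
def definableSubsets (L : MSLanguage.{u, v, v'}) {M : L.Sorts → Type w} [L.Structure M]
    {n : ℕ} {σ : Fin n → L.Sorts} (G : Set (∀ i, M (σ i))) : Set (Set G) :=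
  {X | L.Definable (Subtype.val '' X : Set (∀ i, M (σ i)))}

/-- `X` is a type-definable subset of `G`: an intersection of fewer than `κ` definable subsets. -/
def IsTypeDefinable (L : MSLanguage.{u, v, v'}) {M : L.Sorts → Type w} [L.Structure M]
    (κ : Cardinal.{max u w}) {n : ℕ} {σ : Fin n → L.Sorts} {G : Set (∀ i, M (σ i))}
    (X : Set G) : Prop :=
  ∃ F : Set (Set G), F ⊆ L.definableSubsets G ∧ Cardinal.lift.{u} #F < κ ∧ X = ⋂₀ F

end MSLanguage

/-! ### Rough measures -/

/-- `1 ∈ X = X⁻¹`. -/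
def IsSymmetricSubset {G : Type w} [Group G] (X : Set G) : Prop :=
  1 ∈ X ∧ X = X⁻¹

/-- `μ` restricts to a `T`-rough measure on the collection `𝒜` of subsets of `G`. The values of `μ`
outside `𝒜` are irrelevant. -/
structure IsRoughMeasure {G : Type w} [Group G] (𝒜 : Set (Set G)) (T : Set G)
    (μ : Set G → ℝ≥0∞) : Prop where
  mono : ∀ X ∈ 𝒜, ∀ Y ∈ 𝒜, X ⊆ Y → μ X ≤ μ Y
  union_le : ∀ X ∈ 𝒜, ∀ Y ∈ 𝒜, μ (X ∪ Y) ≤ μ X + μ Y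
  union_eq : ∀ Y ∈ 𝒜, ∀ Z ∈ 𝒜, Y ∩ (Z * T) = ∅ → μ (Y ∪ Z) = μ Y + μ Z

/-- The sequence `μ` witnesses that `A` is `T`-rough definably amenable, `𝒜` being the definable
subsets of `G`: each `μ i` is a left invariant `T i`-rough measure normalised at `A`. -/
structure IsRoughAmenabilityWitness {G : Type w} [Group G] (𝒜 : Set (Set G)) (A : Set G)
    (T : ℕ → Set G) (μ : ℕ → Set G → ℝ≥0∞) : Prop where
  rough : ∀ i, IsRoughMeasure 𝒜 (T i) (μ i)
  left_invariant : ∀ i, ∀ g : G, ∀ X ∈ 𝒜, μ i (g • X) = μ i X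
  normalised : ∀ i, μ i A = 1

/-- A sequence of definable symmetric sets with `T (i + 1) ^ 2 ⊆ T i` and
`a⁻¹ * T (i + 1) * a ⊆ T i` for `a ∈ A`. -/
structure IsThickeningSequence {G : Type w} [Group G] (𝒜 : Set (Set G)) (A : Set G)
    (T : ℕ → Set G) : Prop where
  definable : ∀ i, T i ∈ 𝒜
  symmetric : ∀ i, IsSymmetricSubset (T i)
  sq_subset : ∀ i, T (i + 1) ^ 2 ⊆ T i
  conj_subset : ∀ i, ∀ a ∈ A, ∀ t ∈ T (i + 1), a⁻¹ * t * a ∈ T i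

/-! The group N is built from decreasing chains E 0 ⊇ E 1 ⊇ … of definable sets with E (n + 1)² ⊆ E
n and (E (n + 1))⁻¹ ⊆ E n. Here E n = X⁴ T_k with X a "generic piece": definable, symmetric, inside
a power of A, with finitely many translates covering A. The intersection of a chain is a group, but
need not be normal in Γ = ⟨A T_∞⟩, so N is made from normal cores.

The heart is `exists_generic_pow_subset`: a generic piece X contains in X² another one, S, with S⁸ ⊆
X⁴ T_j. One would like S to consist of the g for which B and its translate g B W meet in large
measure, but the measures are not definable. `Recurrent` replaces "large measure" by a first-order
condition, indexed by a list of numbers, which holds for every set of measure at least t once the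
list is chosen for t. This uniformity comes from packing: among many translates inside a set of
finite measure two must overlap substantially, in both directions. An energy decrement then finds a
recurrent B for which passing to B ∩ g B W, with g in S, hardly lowers the measures of the
thickenings E_i B of B A. Hence E_i B is almost contained in g E_{i+1} B, and along a product of p
elements of S the losses add up to less than μ A. So E_0 B meets its translate, which places the
product near X⁴.

Iterating (`IsGenericPiece.exists_refinement`) gives a chain starting at A⁴ T_k. Packing also shows
that finitely many translates of E n cover A^m. Thus countably many translates of each E n cover Γ,
so countably many conjugates suffice to compute the normal core of ⋂ E n, and recording the
translates in which points lie bounds the index by 2^ℵ₀. The core contains T_∞, which Γ normalises.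
Intersecting the cores over all k gives N inside ⋂ A⁴ T_k, which is A⁴ T_∞ by saturation. -/

namespace MSLanguage

/-! ### Renaming of variables -/

section Rename

variable {L : MSLanguage.{u, v, v'}} {M : L.Sorts → Type w} [L.Structure M]

/-- Replace the variables of a term. -/
def Term.rename {V W : L.Sorts → Type w} (ρ : ∀ s, V s → W s) :
    ∀ {s : L.Sorts}, L.Term V s → L.Term W s
  | _, .var x => .var (ρ _ x)
  | _, .func f ts => .func f (fun k => (ts k).rename ρ)

/-- Extend a renaming by the identity on the new variable. -/
def extRename {S : Type u} {V W : S → Type w} (ρ : ∀ s, V s → W s) (s : S) :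
    ∀ s', ExtVar V s s' → ExtVar W s s' :=
  fun s' => Sum.map (ρ s') id

/-- Replace the free variables of a formula. -/
def Formula.rename : ∀ {V W : L.Sorts → Type w} (_ : ∀ s, V s → W s),
    L.Formula V → L.Formula W
  | _, _, _, .falsum => .falsum
  | _, _, ρ, .equal t₁ t₂ => .equal (t₁.rename ρ) (t₂.rename ρ)
  | _, _, ρ, .rel R ts => .rel R (fun k => (ts k).rename ρ)
  | _, _, ρ, .imp φ ψ => .imp (φ.rename ρ) (ψ.rename ρ)
  | _, _, ρ, .all s φ => .all s (φ.rename (extRename ρ s))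

theorem Term.realize_rename {V W : L.Sorts → Type w} (ρ : ∀ s, V s → W s)
    (e : ∀ s, W s → M s) {s : L.Sorts} (t : L.Term V s) :
    (t.rename ρ).realize e = t.realize (fun s x => e s (ρ s x)) := by
  induction t with
  | var x => rfl
  | func f ts ih =>
    simp only [Term.rename, Term.realize]
    congr 1
    funext k
    exact ih k

theorem extAssign_extRename {S : Type u} {M : S → Type v} {V W : S → Type w}
    (ρ : ∀ s, V s → W s) (e : ∀ s, W s → M s) {s : S} (m : M s) :
    (fun s' x => extAssign e m s' (extRename ρ s s' x)) =
      extAssign (fun s x => e s (ρ s x)) m := by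
  funext s' x
  rcases x with x | ⟨⟨rfl⟩⟩ <;> rfl

theorem Formula.realize_rename {V W : L.Sorts → Type w} (ρ : ∀ s, V s → W s)
    (φ : L.Formula V) (e : ∀ s, W s → M s) :
    (φ.rename ρ).Realize e ↔ φ.Realize (fun s x => e s (ρ s x)) := by
  induction φ generalizing W with
  | falsum => exact Iff.rfl
  | equal t₁ t₂ => simp only [Formula.rename, Formula.Realize, Term.realize_rename]
  | rel R ts => simp only [Formula.rename, Formula.Realize, Term.realize_rename]
  | imp φ ψ ihφ ihψ => simp only [Formula.rename, Formula.Realize, ihφ, ihψ]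
  | all s φ ih =>
    simp only [Formula.rename, Formula.Realize, ih]
    refine forall_congr' fun m => ?_
    rw [extAssign_extRename]

/-! ### Finite support of terms and formulas -/

/-- The subfamily of the variables that lie in `F`. -/
abbrev SubVar {S : Type u} {V : S → Type w} (F : Set (Σ s, V s)) : S → Type w :=
  fun s => {x : V s // (⟨s, x⟩ : Σ s, V s) ∈ F}

/-- Inclusion of subfamilies of variables. -/
def SubVar.incl {S : Type u} {V : S → Type w} {F F' : Set (Σ s, V s)} (h : F ⊆ F') :
    ∀ s, SubVar F s → SubVar F' s :=
  fun _ x => ⟨x.1, h x.2⟩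

theorem Term.exists_finite_support {V : L.Sorts → Type w} {s : L.Sorts} (t : L.Term V s) :
    ∃ F : Set (Σ s, V s), F.Finite ∧ ∃ t' : L.Term (SubVar F) s,
      t'.rename (fun _ x => x.1) = t := by
  induction t with
  | @var s x => exact ⟨{⟨s, x⟩}, Set.finite_singleton _, .var ⟨x, rfl⟩, rfl⟩
  | func f ts ih =>
    choose F hF t' ht' using ih
    refine ⟨⋃ k, F k, Set.finite_iUnion hF,
      .func f fun k => (t' k).rename (SubVar.incl (Set.subset_iUnion F k)), ?_⟩
    simp only [Term.rename]
    congr 1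
    funext k
    rw [← ht' k]
    generalize t' k = t
    have : ∀ {s : L.Sorts} (t : L.Term (SubVar (F k)) s),
        (t.rename (SubVar.incl (Set.subset_iUnion F k))).rename (fun _ x => x.1)
          = t.rename (fun _ x => x.1) := by
      intro s t
      induction t with
      | var x => rfl
      | func f ts ih => simp only [Term.rename]; congr 1; funext k; exact ih k
    exact this _

/-- This keeps parameter sets small: a countable family of definable sets then needs only countably
many parameters, which is what saturation can handle. -/
theorem Formula.exists_finite_support {V : L.Sorts → Type w} (φ : L.Formula V) :
    ∃ F : Set (Σ s, V s), F.Finite ∧ ∃ φ' : L.Formula (SubVar F),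
      ∀ e : ∀ s, V s → M s, φ'.Realize (fun s x => e s x.1) ↔ φ.Realize e := by
  induction φ with
  | falsum => exact ⟨∅, Set.finite_empty, .falsum, fun _ => Iff.rfl⟩
  | equal t₁ t₂ =>
    obtain ⟨F₁, hF₁, t₁, rfl⟩ := t₁.exists_finite_support
    obtain ⟨F₂, hF₂, t₂, rfl⟩ := t₂.exists_finite_support
    refine ⟨F₁ ∪ F₂, hF₁.union hF₂,
      .equal (t₁.rename (SubVar.incl Set.subset_union_left))
        (t₂.rename (SubVar.incl Set.subset_union_right)), fun e => ?_⟩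
    simp only [Formula.Realize, Term.realize_rename]
    exact Iff.rfl
  | rel R ts =>
    have h := fun k => (ts k).exists_finite_support
    choose F hF t' ht' using h
    refine ⟨⋃ k, F k, Set.finite_iUnion hF,
      .rel R fun k => (t' k).rename (SubVar.incl (Set.subset_iUnion F k)), fun e => ?_⟩
    simp only [Formula.Realize, Term.realize_rename, ← ht']
    exact Iff.rfl
  | imp φ ψ ihφ ihψ =>
    obtain ⟨F₁, hF₁, φ', hφ⟩ := ihφ
    obtain ⟨F₂, hF₂, ψ', hψ⟩ := ihψ
    refine ⟨F₁ ∪ F₂, hF₁.union hF₂,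
      .imp (φ'.rename (SubVar.incl Set.subset_union_left))
        (ψ'.rename (SubVar.incl Set.subset_union_right)), fun e => ?_⟩
    simp only [Formula.Realize, Formula.realize_rename, ← hφ, ← hψ]
    exact Iff.rfl
  | @all V s φ ih =>
    obtain ⟨F, hF, φ', hφ⟩ := ih
    let j : (Σ s', V s') → Σ s', ExtVar V s s' := fun p => ⟨p.1, Sum.inl p.2⟩
    have hj : Function.Injective j := by
      rintro ⟨a, x⟩ ⟨b, y⟩ h
      simp only [j] at h
      obtain ⟨rfl, h⟩ := h
      simp
    let ρ : ∀ s', SubVar F s' → ExtVar (SubVar (j ⁻¹' F)) s s' := fun s' x =>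
      match x with
      | ⟨Sum.inl y, hy⟩ => Sum.inl ⟨y, hy⟩
      | ⟨Sum.inr y, _⟩ => Sum.inr y
    refine ⟨j ⁻¹' F, hF.preimage hj.injOn, .all s (φ'.rename ρ), fun e => ?_⟩
    simp only [Formula.Realize, Formula.realize_rename]
    refine forall_congr' fun m => ?_
    rw [← hφ]
    refine iff_of_eq (congrArg _ ?_)
    funext s' x
    rcases x with ⟨x | ⟨⟨rfl⟩⟩, hx⟩ <;> rfl

end Rename

/-! ### Closure properties of definable sets -/

section Definable

variable {L : MSLanguage.{u, v, v'}} {M : L.Sorts → Type w} [L.Structure M]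

namespace Definable

theorem compl {ι : Type} {σ : ι → L.Sorts} {X : Set (∀ i, M (σ i))} (hX : L.Definable X) :
    L.Definable Xᶜ := by
  obtain ⟨φ, hφ⟩ := hX
  exact ⟨.imp φ .falsum, fun x => by rw [Set.mem_compl_iff, hφ]; exact Iff.rfl⟩

theorem univ {ι : Type} {σ : ι → L.Sorts} : L.Definable (Set.univ : Set (∀ i, M (σ i))) :=
  ⟨.imp .falsum .falsum, fun _ => iff_of_true trivial id⟩

theorem inter {ι : Type} {σ : ι → L.Sorts} {X Y : Set (∀ i, M (σ i))} (hX : L.Definable X)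
    (hY : L.Definable Y) : L.Definable (X ∩ Y) := by
  obtain ⟨φ, hφ⟩ := hX
  obtain ⟨ψ, hψ⟩ := hY
  refine ⟨.imp (.imp φ (.imp ψ .falsum)) .falsum, fun x => ?_⟩
  rw [Set.mem_inter_iff, hφ, hψ]
  simp only [Formula.Realize]
  tauto

theorem iInter {ι : Type} {σ : ι → L.Sorts} {κ : Type*} [Finite κ]
    {X : κ → Set (∀ i, M (σ i))} (hX : ∀ k, L.Definable (X k)) : L.Definable (⋂ k, X k) := by
  classical
  have h : ∀ s : Set κ, s.Finite → L.Definable (⋂ k ∈ s, X k) := by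
    intro s hs
    induction s, hs using Set.Finite.induction_on with
    | empty => simpa using univ
    | insert _ _ ih => rw [Set.biInter_insert]; exact (hX _).inter ih
  simpa using h Set.univ Set.finite_univ

/-- Substitution of variables and constants for the free variables. -/
theorem subst {ι ι' : Type} {σ : ι → L.Sorts} {σ' : ι' → L.Sorts} {X : Set (∀ i, M (σ i))}
    (hX : L.Definable X) (f : ∀ i, {i' : ι' // σ' i' = σ i} ⊕ M (σ i)) :
    L.Definable {x : ∀ i, M (σ' i) |
      (fun i => Sum.elim (fun j : {i' : ι' // σ' i' = σ i} => j.2 ▸ x j.1) id (f i)) ∈ X} := by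
  obtain ⟨φ, hφ⟩ := hX
  let ρ : ∀ s, ParamVar (fun s => (Set.univ : Set (M s))) σ s →
      ParamVar (fun s => (Set.univ : Set (M s))) σ' s := fun s x =>
    match x with
    | Sum.inl c => Sum.inl c
    | Sum.inr ⟨i, h⟩ => match f i with
      | Sum.inl j => Sum.inr ⟨j.1, j.2.trans h⟩
      | Sum.inr m => Sum.inl ⟨h ▸ m, trivial⟩
  refine ⟨φ.rename ρ, fun x => ?_⟩
  rw [Set.mem_ofPred_eq, hφ, Formula.realize_rename]
  refine iff_of_eq (congrArg _ ?_)
  funext s y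
  rcases y with c | ⟨i, rfl⟩
  · rfl
  · simp only [paramAssign, ρ]
    rcases f i with ⟨j, hj⟩ | m
    · simp only [Sum.elim_inl]
      generalize σ i = s at hj
      subst hj
      rfl
    · rfl

theorem exists_update {ι : Type} [DecidableEq ι] {σ : ι → L.Sorts} {X : Set (∀ i, M (σ i))}
    (hX : L.Definable X) (i : ι) :
    L.Definable {x : ∀ i, M (σ i) | ∃ m : M (σ i), Function.update x i m ∈ X} := by
  obtain ⟨φ, hφ⟩ := hX
  let ρ : ∀ s, ParamVar (fun s => (Set.univ : Set (M s))) σ s →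
      ExtVar (ParamVar (fun s => (Set.univ : Set (M s))) σ) (σ i) s := fun s x =>
    match x with
    | Sum.inl c => Sum.inl (Sum.inl c)
    | Sum.inr ⟨j, h⟩ => if hj : j = i then Sum.inr ⟨hj ▸ h⟩ else Sum.inl (Sum.inr ⟨j, h⟩)
  refine ⟨.imp (.all (σ i) (.imp (φ.rename ρ) .falsum)) .falsum, fun x => ?_⟩
  simp only [Set.mem_ofPred_eq, Formula.Realize, Formula.realize_rename, hφ]
  rw [← not_forall_not]
  refine not_congr (forall_congr' fun m => not_congr (iff_of_eq (congrArg _ ?_)))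
  funext s y
  rcases y with c | ⟨j, rfl⟩
  · rfl
  · by_cases hj : j = i
    · subst hj
      simp [ρ, paramAssign, extAssign]
    · simp [ρ, paramAssign, extAssign, hj]

theorem exists_off {ι : Type} {σ : ι → L.Sorts} {X : Set (∀ i, M (σ i))}
    (hX : L.Definable X) {J : Set ι} (hJ : J.Finite) :
    L.Definable {x : ∀ i, M (σ i) | ∃ y ∈ X, ∀ i ∉ J, y i = x i} := by
  classical
  induction J, hJ using Set.Finite.induction_on with
  | empty =>
    convert hX using 1
    ext x
    constructor
    · rintro ⟨y, hy, h⟩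
      rwa [← show y = x from funext fun i => h i (by simp)]
    · exact fun hx => ⟨x, hx, fun _ _ => rfl⟩
  | @insert a s _ _ ih =>
    convert ih.exists_update a using 1
    ext x
    constructor
    · rintro ⟨y, hy, h⟩
      refine ⟨y a, y, hy, fun i hi => ?_⟩
      by_cases hia : i = a
      · subst hia; simp
      · rw [Function.update_of_ne hia]; exact h i (by simp [hia, hi])
    · rintro ⟨m, y, hy, h⟩
      refine ⟨y, hy, fun i hi => ?_⟩
      simp only [Set.mem_insert_iff, not_or] at hi
      rw [h i hi.2, Function.update_of_ne hi.1]

theorem proj {ι ι' : Type} [Finite ι'] {σ : ι' → L.Sorts} {X : Set (∀ i, M (σ i))}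
    (hX : L.Definable X) (e : ι → ι') (he : Function.Injective e) :
    L.Definable (σ := fun i => σ (e i))
      {x : ∀ i, M (σ (e i)) | ∃ y ∈ X, ∀ i, y (e i) = x i} := by
  classical
  -- The quantified coordinates no longer matter and are filled with those of z. A sort may be
  -- empty, so these constants have to come from a point of X.
  rcases X.eq_empty_or_nonempty with rfl | ⟨z, hz⟩
  · simpa using (univ (L := L) (M := M) (σ := fun i => σ (e i))).compl
  have h := (hX.exists_off (Set.toFinite (Set.range e)ᶜ)).subst (σ' := fun i => σ (e i))
    (fun i' => if h : i' ∈ Set.range e then Sum.inl ⟨h.choose, congrArg σ h.choose_spec⟩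
      else Sum.inr (z i'))
  convert h using 1
  ext x
  simp only [Set.mem_ofPred_eq]
  refine exists_congr fun y => and_congr_right fun _ => ?_
  have key : ∀ i, Sum.elim (fun j : {j : ι // σ (e j) = σ (e i)} => j.2 ▸ x j.1) id
      (if h : e i ∈ Set.range e then Sum.inl ⟨h.choose, congrArg σ h.choose_spec⟩
      else Sum.inr (z (e i))) = x i := by
    intro i
    have hi : e i ∈ Set.range e := ⟨i, rfl⟩
    rw [dif_pos hi]
    simp only [Sum.elim_inl]
    have h1 : hi.choose = i := he hi.choose_spec
    have : ∀ (j : ι) (hj : j = i) (hs : σ (e j) = σ (e i)), hs ▸ x j = x i := by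
      rintro j rfl _; rfl
    exact this _ h1 _
  constructor
  · intro hy i' hi'
    have hi' : i' ∈ Set.range e := by simpa using hi'
    obtain ⟨i, rfl⟩ := hi'
    rw [hy i]; exact (key i).symm
  · intro hy i
    rw [hy (e i) (by simp)]
    exact key i

end Definable

end Definable

end MSLanguage

namespace MSLanguage

/-! ### Definable relations on a definable set of tuples -/

section DefRel

variable {L : MSLanguage.{u, v, v'}} {M : L.Sorts → Type w}
variable {n : ℕ} {σ : Fin n → L.Sorts} {G : Set (∀ i, M (σ i))}

/-- The set of families of coordinates of the families of elements of `G` that satisfy `R`. -/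
def relSet {ι : Type} (R : (ι → G) → Prop) : Set (∀ p : Fin n × ι, M (σ p.1)) :=
  {x | ∃ g : ι → G, (∀ p, x p = (g p.2).1 p.1) ∧ R g}

/-- The coordinates of a family of elements of `G`. -/
def coords {ι : Type} (g : ι → G) : ∀ p : Fin n × ι, M (σ p.1) := fun p => (g p.2).1 p.1

theorem coords_injective {ι : Type} :
    Function.Injective (coords : (ι → G) → ∀ p : Fin n × ι, M (σ p.1)) := by
  intro g h hgh
  funext i
  refine Subtype.ext (funext fun q => congrFun hgh (q, i))

theorem coords_mem_relSet {ι : Type} {R : (ι → G) → Prop} {g : ι → G} :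
    coords g ∈ relSet R ↔ R g := by
  constructor
  · rintro ⟨h, hh, hR⟩
    rwa [show g = h from coords_injective (funext hh)]
  · exact fun h => ⟨g, fun _ => rfl, h⟩

theorem mem_relSet {ι : Type} {R : (ι → G) → Prop} {x : ∀ p : Fin n × ι, M (σ p.1)} :
    x ∈ relSet R ↔ ∃ g, x = coords g ∧ R g :=
  exists_congr fun _ => and_congr_left fun _ => funext_iff.symm

variable [L.Structure M]

variable (L) in
/-- A relation on `G` with arguments indexed by `ι` is definable. -/
def DefRel {ι : Type} (R : (ι → G) → Prop) : Prop :=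
  L.Definable (σ := fun p : Fin n × ι => σ p.1) (relSet R)

theorem defRel_mem_iff {X : Set G} :
    L.DefRel (fun g : Unit → G => g () ∈ X) ↔ X ∈ L.definableSubsets G := by
  constructor
  · intro h
    have := Definable.subst (σ' := σ) h (fun p => Sum.inl ⟨p.1, rfl⟩)
    show L.Definable _
    convert this using 1
    ext x
    simp only [Set.mem_ofPred_eq, Sum.elim_inl, mem_relSet]
    constructor
    · rintro ⟨a, ha, rfl⟩
      exact ⟨fun _ => a, rfl, ha⟩
    · rintro ⟨g, hg, hgX⟩
      exact ⟨g (), hgX, funext fun q => (congrFun hg (q, ())).symm⟩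
  · intro h
    have := Definable.subst (σ' := fun p : Fin n × Unit => σ p.1) h
      (fun q => Sum.inl ⟨(q, ()), rfl⟩)
    show L.Definable _
    convert this using 1
    ext x
    simp only [Set.mem_ofPred_eq, Sum.elim_inl, mem_relSet]
    constructor
    · rintro ⟨g, rfl, hg⟩
      exact ⟨g (), hg, rfl⟩
    · rintro ⟨a, ha, hx⟩
      exact ⟨fun _ => a, funext fun p => (congrFun hx p.1).symm, ha⟩

namespace DefRel

theorem and {ι : Type} {R S : (ι → G) → Prop} (hR : L.DefRel R) (hS : L.DefRel S) :
    L.DefRel (fun g => R g ∧ S g) := by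
  unfold DefRel
  convert Definable.inter hR hS using 1
  ext x
  simp only [Set.mem_inter_iff, mem_relSet]
  constructor
  · rintro ⟨g, rfl, h1, h2⟩; exact ⟨⟨g, rfl, h1⟩, ⟨g, rfl, h2⟩⟩
  · rintro ⟨⟨g, rfl, h1⟩, ⟨g', h, h2⟩⟩
    obtain rfl := coords_injective h
    exact ⟨g, rfl, h1, h2⟩

theorem exists_block {ι κ : Type} [Finite ι] [Finite κ] {R : (ι ⊕ κ → G) → Prop}
    (hR : L.DefRel R) : L.DefRel (fun g : ι → G => ∃ h : κ → G, R (Sum.elim g h)) := by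
  unfold DefRel
  convert Definable.proj hR (fun p : Fin n × ι => (p.1, Sum.inl p.2))
    (by rintro ⟨a, b⟩ ⟨c, d⟩ h; simpa using h) using 1
  ext x
  simp only [Set.mem_ofPred_eq, mem_relSet]
  constructor
  · rintro ⟨g, rfl, h, hh⟩; exact ⟨_, ⟨_, rfl, hh⟩, fun _ => rfl⟩
  · rintro ⟨_, ⟨f, rfl, hf⟩, h⟩
    refine ⟨f ∘ Sum.inl, funext fun p => (h p).symm, f ∘ Sum.inr, ?_⟩
    rwa [Sum.elim_comp_inl_inr]

theorem exists_one {ι : Type} [Finite ι] {R : (ι → G) → G → Prop}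
    (hR : L.DefRel (fun g : ι ⊕ Unit → G => R (g ∘ Sum.inl) (g (Sum.inr ())))) :
    L.DefRel (fun g => ∃ a, R g a) := by
  convert hR.exists_block using 2 with g
  constructor
  · rintro ⟨a, h⟩; exact ⟨fun _ => a, h⟩
  · rintro ⟨a, h⟩; exact ⟨a (), h⟩

section

variable (hG : L.Definable G)
include hG

theorem true {ι : Type} [Finite ι] : L.DefRel (fun _ : ι → G => True) := by
  unfold DefRel
  convert Definable.iInter (fun i : ι => Definable.subst (σ' := fun p : Fin n × ι => σ p.1) hG
      (fun q => Sum.inl ⟨(q, i), rfl⟩)) using 1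
  ext x
  simp only [Set.mem_ofPred_eq, Sum.elim_inl, mem_relSet, and_true, Set.mem_iInter]
  constructor
  · rintro ⟨g, rfl⟩ i; exact (g i).2
  · intro h; exact ⟨fun i => ⟨_, h i⟩, rfl⟩

/-- Negation is relative to the definable set of families in G, since `relSet` contains only
coordinates of such families. -/
theorem not {ι : Type} [Finite ι] {R : (ι → G) → Prop} (hR : L.DefRel R) :
    L.DefRel (fun g => ¬ R g) := by
  unfold DefRel
  convert Definable.inter (true hG (ι := ι)) (Definable.compl hR) using 1
  ext x
  simp only [Set.mem_inter_iff, Set.mem_compl_iff, mem_relSet, and_true]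
  constructor
  · rintro ⟨g, rfl, h⟩
    refine ⟨⟨g, rfl⟩, ?_⟩
    rintro ⟨g', h1, h2⟩
    obtain rfl := coords_injective h1
    exact h h2
  · rintro ⟨⟨g, rfl⟩, h⟩
    exact ⟨g, rfl, fun h' => h ⟨g, rfl, h'⟩⟩

theorem or {ι : Type} [Finite ι] {R S : (ι → G) → Prop} (hR : L.DefRel R)
    (hS : L.DefRel S) : L.DefRel (fun g => R g ∨ S g) := by
  simpa only [not_and_or, not_not] using ((hR.not hG).and (hS.not hG)).not hG

theorem imp {ι : Type} [Finite ι] {R S : (ι → G) → Prop} (hR : L.DefRel R)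
    (hS : L.DefRel S) : L.DefRel (fun g => R g → S g) := by
  simpa only [imp_iff_not_or] using (hR.not hG).or hG hS

theorem all {ι κ : Type} [Finite ι] [Finite κ] {R : κ → (ι → G) → Prop}
    (hR : ∀ k, L.DefRel (R k)) : L.DefRel (fun g => ∀ k, R k g) := by
  unfold DefRel
  convert Definable.inter (true hG (ι := ι)) (Definable.iInter hR) using 1
  ext x
  simp only [Set.mem_inter_iff, Set.mem_iInter, mem_relSet, and_true]
  constructor
  · rintro ⟨g, rfl, h⟩
    exact ⟨⟨g, rfl⟩, fun k => ⟨g, rfl, h k⟩⟩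
  · rintro ⟨⟨g, rfl⟩, h⟩
    refine ⟨g, rfl, fun k => ?_⟩
    obtain ⟨g', h1, h2⟩ := h k
    obtain rfl := coords_injective h1
    exact h2

theorem any {ι κ : Type} [Finite ι] [Finite κ] {R : κ → (ι → G) → Prop}
    (hR : ∀ k, L.DefRel (R k)) : L.DefRel (fun g => ∃ k, R k g) := by
  simpa only [not_forall, not_not] using (all hG fun k => (hR k).not hG).not hG

theorem forall_block {ι κ : Type} [Finite ι] [Finite κ] {R : (ι ⊕ κ → G) → Prop}
    (hR : L.DefRel R) : L.DefRel (fun g : ι → G => ∀ h : κ → G, R (Sum.elim g h)) := by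
  simpa only [not_exists, not_not] using ((hR.not hG).exists_block).not hG

/-- Substitution of variables and constants for the arguments of a definable relation. -/
theorem subst {ι κ : Type} [Finite ι] {R : (κ → G) → Prop}
    (hR : L.DefRel R) (f : κ → ι ⊕ G) :
    L.DefRel (fun g : ι → G => R fun k => Sum.elim g id (f k)) := by
  unfold DefRel
  convert Definable.inter (true hG (ι := ι)) (Definable.subst
    (σ' := fun p : Fin n × ι => σ p.1) hR
    (fun p => (f p.2).map (fun i => ⟨(p.1, i), rfl⟩) (fun c => c.1 p.1))) using 1
  ext x
  rw [Set.mem_inter_iff]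
  have key : ∀ g : ι → G, (fun p : Fin n × κ => Sum.elim
      (fun j : {i' : Fin n × ι // σ i'.1 = σ p.1} => j.2 ▸ coords g j.1) id
      ((f p.2).map (fun i => ⟨(p.1, i), rfl⟩) (fun c => c.1 p.1))) =
      coords fun k => Sum.elim g id (f k) := by
    intro g
    funext p
    rcases h : f p.2 with i | c <;> simp [coords, h]
  constructor
  · rintro h
    obtain ⟨g, rfl, h⟩ := mem_relSet.1 h
    refine ⟨mem_relSet.2 ⟨g, rfl, trivial⟩, ?_⟩
    rw [Set.mem_ofPred_eq, key g, coords_mem_relSet]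
    exact (coords_mem_relSet (R := fun g : ι → G => R fun k => Sum.elim g id (f k))).1 h
  · rintro ⟨h1, h2⟩
    obtain ⟨g, rfl, -⟩ := mem_relSet.1 h1
    rw [Set.mem_ofPred_eq, key g, coords_mem_relSet] at h2
    exact mem_relSet.2 ⟨g, rfl, h2⟩

end

end DefRel

variable [Group G]

variable (L) in
/-- A function on `G` with arguments indexed by `ι` is definable. -/
def DefFun {ι : Type} (t : (ι → G) → G) : Prop :=
  L.DefRel (fun g : ι ⊕ Unit → G => g (Sum.inr ()) = t (g ∘ Sum.inl))

theorem defRel_mul (hG : L.IsDefinableGroup G) :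
    L.DefRel (fun g : Fin 3 → G => g 2 = g 0 * g 1) := by
  unfold DefRel
  convert hG.definable_mul using 1
  ext x
  rw [mem_relSet]
  constructor
  · rintro ⟨g, rfl, h⟩
    refine ⟨g 0, g 1, fun _ => rfl, fun _ => rfl, fun i => ?_⟩
    rw [← h]; rfl
  · rintro ⟨a, b, h0, h1, h2⟩
    refine ⟨![a, b, a * b], funext ?_, rfl⟩
    rintro ⟨q, k⟩
    fin_cases k
    · exact h0 q
    · exact h1 q
    · exact h2 q

section

variable (hG : L.IsDefinableGroup G)
include hG

/-- Equality is read off the graph of multiplication with second factor 1. -/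
theorem defRel_eq : L.DefRel (fun g : Fin 2 → G => g 0 = g 1) := by
  have := (defRel_mul hG).subst hG.definable_carrier (ι := Fin 2)
    ![Sum.inl 1, Sum.inr 1, Sum.inl 0]
  simpa using this

theorem DefRel.comp {ι κ : Type} [Finite ι] [Finite κ] {R : (κ → G) → Prop} (hR : L.DefRel R)
    {t : κ → (ι → G) → G} (ht : ∀ k, L.DefFun (t k)) :
    L.DefRel (fun g : ι → G => R fun k => t k g) := by
  have h1 : ∀ k, L.DefRel (fun g : ι ⊕ κ → G => g (Sum.inr k) = t k (g ∘ Sum.inl)) := by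
    intro k
    exact DefRel.subst hG.definable_carrier (ι := ι ⊕ κ) (ht k)
      (Sum.elim (fun i => Sum.inl (Sum.inl i)) fun _ => Sum.inl (Sum.inr k))
  have h2 := (DefRel.all hG.definable_carrier h1).and
    (DefRel.subst hG.definable_carrier (ι := ι ⊕ κ) hR fun k => Sum.inl (Sum.inr k))
  have h3 := h2.exists_block
  convert h3 using 2 with g
  constructor
  · exact fun h => ⟨fun k => t k g, fun k => rfl, h⟩
  · rintro ⟨h, h4, h5⟩
    obtain rfl : h = fun k => t k g := funext h4
    exact h5

theorem DefFun.var {ι : Type} [Finite ι] (i : ι) : L.DefFun (fun g : ι → G => g i) := by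
  have := (defRel_eq hG).subst hG.definable_carrier (ι := ι ⊕ Unit)
    ![Sum.inl (Sum.inr ()), Sum.inl (Sum.inl i)]
  exact this

theorem DefFun.const {ι : Type} [Finite ι] (c : G) : L.DefFun (fun _ : ι → G => c) := by
  have := (defRel_eq hG).subst hG.definable_carrier (ι := ι ⊕ Unit)
    ![Sum.inl (Sum.inr ()), Sum.inr c]
  exact this

theorem DefFun.mul {ι : Type} [Finite ι] {s t : (ι → G) → G} (hs : L.DefFun s)
    (ht : L.DefFun t) : L.DefFun (fun g => s g * t g) := by
  have h1 : ∀ {t : (ι → G) → G}, L.DefFun t →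
      L.DefFun (fun g : ι ⊕ Unit → G => t (g ∘ Sum.inl)) := fun h =>
    DefRel.subst hG.definable_carrier (ι := (ι ⊕ Unit) ⊕ Unit) h
      (Sum.elim (fun i => Sum.inl (Sum.inl (Sum.inl i))) fun _ => Sum.inl (Sum.inr ()))
  have := (defRel_mul hG).comp hG (ι := ι ⊕ Unit)
    (t := ![fun g => s (g ∘ Sum.inl), fun g => t (g ∘ Sum.inl), fun g => g (Sum.inr ())])
    (by
      intro k
      fin_cases k
      · exact h1 hs
      · exact h1 ht
      · exact DefFun.var hG _)
  exact this

theorem DefFun.inv {ι : Type} [Finite ι] {t : (ι → G) → G} (ht : L.DefFun t) :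
    L.DefFun (fun g => (t g)⁻¹) := by
  have h1 : L.DefFun (fun g : ι ⊕ Unit → G => t (g ∘ Sum.inl)) :=
    DefRel.subst hG.definable_carrier (ι := (ι ⊕ Unit) ⊕ Unit) ht
      (Sum.elim (fun i => Sum.inl (Sum.inl (Sum.inl i))) fun _ => Sum.inl (Sum.inr ()))
  have := (defRel_mul hG).comp hG (ι := ι ⊕ Unit)
    (t := ![fun g => t (g ∘ Sum.inl), fun g => g (Sum.inr ()), fun _ => 1])
    (by
      intro k
      fin_cases k
      · exact h1
      · exact DefFun.var hG _
      · exact DefFun.const hG _)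
  unfold DefFun
  convert this using 2 with g
  rw [eq_inv_iff_mul_eq_one, ← mul_eq_one_comm]
  exact eq_comm

theorem DefRel.mem {ι : Type} [Finite ι] {X : Set G} (hX : X ∈ L.definableSubsets G)
    {t : (ι → G) → G} (ht : L.DefFun t) : L.DefRel (fun g => t g ∈ X) :=
  (defRel_mem_iff.2 hX).comp hG (t := fun _ => t) fun _ => ht

end

end DefRel

/-! ### Saturation -/

section Saturation

variable {L : MSLanguage.{u, v, v'}} {M : L.Sorts → Type w} [L.Structure M]

/-- A definable set is defined by a formula over finitely many parameters. -/
theorem Definable.exists_finite_params {ι : Type} {σ : ι → L.Sorts} {X : Set (∀ i, M (σ i))}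
    (hX : L.Definable X) : ∃ F : Set (Σ s, M s), F.Finite ∧
      ∀ C : ∀ s, Set (M s), (∀ p ∈ F, p.2 ∈ C p.1) →
        ∃ φ : L.Formula (ParamVar C σ), ∀ x, x ∈ X ↔ φ.Realize (paramAssign C x) := by
  obtain ⟨φ, hφ⟩ := hX
  obtain ⟨F, hF, φ', hφ'⟩ := φ.exists_finite_support (M := M)
  let j : (Σ s, M s) → Σ s, ParamVar (fun s => (Set.univ : Set (M s))) σ s :=
    fun p => ⟨p.1, Sum.inl ⟨p.2, trivial⟩⟩
  have hj : Function.Injective j := by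
    rintro ⟨a, x⟩ ⟨b, y⟩ h
    simp only [j, Sigma.mk.injEq] at h
    obtain ⟨rfl, h⟩ := h
    simpa using congrArg (Sum.elim Subtype.val fun _ => x) (eq_of_heq h)
  refine ⟨j ⁻¹' F, hF.preimage hj.injOn, fun C hC => ?_⟩
  let ρ : ∀ s, SubVar F s → ParamVar C σ s := fun s x =>
    match x with
    | ⟨Sum.inl c, hc⟩ => Sum.inl ⟨c.1, hC ⟨s, c.1⟩ hc⟩
    | ⟨Sum.inr i, _⟩ => Sum.inr i
  refine ⟨φ'.rename ρ, fun x => ?_⟩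
  rw [hφ, ← hφ', Formula.realize_rename]
  refine iff_of_eq (congrArg _ ?_)
  funext s y
  rcases y with ⟨c | ⟨i, rfl⟩, hy⟩ <;> rfl

/-- Each set uses finitely many parameters, so the sequence uses at most ℵ₀ < κ of them, and
saturation applies to the set of defining formulas. -/
theorem IsSaturated.nonempty_iInter {κ : Cardinal.{max u w}} (hκ : ℵ₀ < κ)
    (hM : L.IsSaturated M κ) {ι : Type} [Finite ι] {σ : ι → L.Sorts}
    {X : ℕ → Set (∀ i, M (σ i))} (hX : ∀ k, L.Definable (X k))
    (hne : ∀ k, (⋂ j ≤ k, X j).Nonempty) : (⋂ k, X k).Nonempty := by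
  choose F hF hφ using fun k => (hX k).exists_finite_params
  let C : ∀ s, Set (M s) := fun s => {c | ∃ k, ⟨s, c⟩ ∈ F k}
  choose φ hφ using fun k => hφ k C fun p hp => ⟨k, hp⟩
  have hcount : #(Σ s, C s) < κ := by
    refine lt_of_le_of_lt ?_ hκ
    rw [Cardinal.mk_le_aleph0_iff]
    have h : (⋃ k, F k).Countable := Set.countable_iUnion fun k => (hF k).countable
    have := h.to_subtype
    refine Function.Injective.countable (β := ↥(⋃ k, F k))
      (f := fun p => ⟨⟨p.1, p.2.1⟩, Set.mem_iUnion.2 p.2.2⟩) ?_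
    rintro ⟨a, x, hx⟩ ⟨b, y, hy⟩ h
    simp only [Subtype.mk.injEq, Sigma.mk.injEq] at h
    obtain ⟨rfl, h⟩ := h
    obtain rfl := eq_of_heq h
    rfl
  obtain ⟨x, hx⟩ := hM C hcount ι σ (Set.range φ) (by
    intro q hq hqf
    obtain ⟨s, hs, rfl⟩ := Set.subset_range_iff_exists_image_eq.1 hq
    -- Infinitely many indices may share a formula, so one index is kept for each formula.
    obtain ⟨t, -, ht, hts⟩ : ∃ t : Set ℕ, t ⊆ s ∧ t.Finite ∧ φ '' t = φ '' s := by
      obtain ⟨t, h1, h2⟩ := Set.exists_subset_bijOn s φ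
      exact ⟨t, h1, Set.Finite.of_finite_image (h2.image_eq ▸ hqf) h2.injOn, h2.image_eq⟩
    obtain ⟨k, hk⟩ := ht.bddAbove
    obtain ⟨x, hx⟩ := hne k
    refine ⟨x, ?_⟩
    rw [← hts]
    rintro _ ⟨j, hj, rfl⟩
    exact (hφ j x).1 (Set.mem_iInter₂.1 hx j (hk hj)))
  exact ⟨x, Set.mem_iInter.2 fun k => (hφ k x).2 (hx _ ⟨k, rfl⟩)⟩

end Saturation

end MSLanguage

/-! ### Recurrence -/

section Recurrence

variable {G : Type w} [Group G]

/-- A combinatorial substitute for being of measure at least some constant: `B` is recurrent for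
`N :: l` if `N` translates of the set of those `g`, for which both `B ∩ g B U` and `B ∩ g⁻¹ B U`
are recurrent for `l`, cover `A`. -/
def Recurrent (A U : Set G) : List ℕ → Set G → Prop
  | [], B => B.Nonempty
  | N :: l, B => ∃ c : Fin N → G, (∀ i, c i ∈ A) ∧ ∀ a ∈ A, ∃ i,
      Recurrent A U l (B ∩ (a⁻¹ * c i) • (B * U)) ∧ Recurrent A U l (B ∩ ((c i)⁻¹ * a) • (B * U))

/-- The set of recurrence times of `B` in `A ^ 2`. -/
def recurrenceSet (A U : Set G) (l : List ℕ) (B : Set G) : Set G :=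
  {g | g ∈ A ^ 2 ∧ Recurrent A U l (B ∩ g • (B * U)) ∧ Recurrent A U l (B ∩ g⁻¹ • (B * U))}

/-- The closure properties of the collection of definable subsets that are used below. -/
structure IsRecurrenceAlgebra (𝒜 : Set (Set G)) : Prop where
  singleton_one : {1} ∈ 𝒜
  empty : ∅ ∈ 𝒜
  inter : ∀ X ∈ 𝒜, ∀ Y ∈ 𝒜, X ∩ Y ∈ 𝒜
  union : ∀ X ∈ 𝒜, ∀ Y ∈ 𝒜, X ∪ Y ∈ 𝒜
  diff : ∀ X ∈ 𝒜, ∀ Y ∈ 𝒜, X \ Y ∈ 𝒜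
  mul : ∀ X ∈ 𝒜, ∀ Y ∈ 𝒜, X * Y ∈ 𝒜
  smul : ∀ g : G, ∀ X ∈ 𝒜, g • X ∈ 𝒜
  conj : ∀ g : G, ∀ X ∈ 𝒜, {x | g⁻¹ * x * g ∈ X} ∈ 𝒜
  recurrenceSet : ∀ A ∈ 𝒜, ∀ U ∈ 𝒜, ∀ B ∈ 𝒜, ∀ l, recurrenceSet A U l B ∈ 𝒜

theorem IsRecurrenceAlgebra.pow {𝒜 : Set (Set G)} (h𝒜 : IsRecurrenceAlgebra 𝒜) {X : Set G}
    (hX : X ∈ 𝒜) (m : ℕ) : X ^ m ∈ 𝒜 := by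
  induction m with
  | zero => rw [pow_zero]; exact h𝒜.singleton_one
  | succ m ih => rw [pow_succ]; exact h𝒜.mul _ ih _ hX

theorem Recurrent.mono {A U : Set G} {l : List ℕ} {B C : Set G} (hBC : B ⊆ C)
    (h : Recurrent A U l B) : Recurrent A U l C := by
  induction l generalizing B C with
  | nil => exact Set.Nonempty.mono hBC h
  | cons N l ih =>
    obtain ⟨c, hc, h⟩ := h
    refine ⟨c, hc, fun a ha => ?_⟩
    obtain ⟨i, h1, h2⟩ := h a ha
    exact ⟨i, ih (by gcongr) h1, ih (by gcongr) h2⟩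

theorem Recurrent.tail {A U : Set G} (hA : (1 : G) ∈ A) {N : ℕ} {l : List ℕ} {B : Set G}
    (h : Recurrent A U (N :: l) B) : Recurrent A U l B := by
  obtain ⟨c, -, h⟩ := h
  obtain ⟨i, h1, -⟩ := h 1 hA
  exact h1.mono Set.inter_subset_left

theorem Recurrent.nonempty {A U : Set G} (hA : (1 : G) ∈ A) {l : List ℕ} {B : Set G}
    (h : Recurrent A U l B) : B.Nonempty := by
  induction l with
  | nil => exact h
  | cons N l ih => exact ih (h.tail hA)

/-- Every tournament on `2 ^ n` vertices has a transitive subtournament with `n` vertices. -/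
theorem exists_pairwise_list_of_tournament {α : Type*} (r : α → α → Prop) (n : ℕ)
    (s : Finset α) (hs : 2 ^ n ≤ s.card) (hr : ∀ a ∈ s, ∀ b ∈ s, a ≠ b → r a b ∨ r b a) :
    ∃ l : List α, l.length = n ∧ (∀ a ∈ l, a ∈ s) ∧ l.Pairwise r := by
  classical
  induction n generalizing s with
  | zero => exact ⟨[], rfl, by simp, List.Pairwise.nil⟩
  | succ n ih =>
    obtain ⟨v, hv⟩ : s.Nonempty := Finset.card_pos.1 (lt_of_lt_of_le (by positivity) hs)
    have hcard : ((s.erase v).filter (fun a => r v a)).card +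
        ((s.erase v).filter (fun a => ¬ r v a)).card + 1 = s.card := by
      rw [Finset.card_filter_add_card_filter_not, Finset.card_erase_add_one hv]
    rw [pow_succ] at hs
    by_cases h : 2 ^ n ≤ ((s.erase v).filter (fun a => r v a)).card
    · obtain ⟨l, hl, hls, hlr⟩ := ih _ h fun a ha b hb =>
        hr a (Finset.mem_of_mem_erase (Finset.mem_filter.1 ha).1) b
          (Finset.mem_of_mem_erase (Finset.mem_filter.1 hb).1)
      refine ⟨v :: l, by simp [hl], ?_, List.pairwise_cons.2 ⟨?_, hlr⟩⟩
      · intro a ha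
        rcases List.mem_cons.1 ha with rfl | ha
        · exact hv
        · exact Finset.mem_of_mem_erase (Finset.mem_filter.1 (hls a ha)).1
      · exact fun a ha => (Finset.mem_filter.1 (hls a ha)).2
    · obtain ⟨l, hl, hls, hlr⟩ := ih ((s.erase v).filter (fun a => ¬ r v a)) (by omega)
        fun a ha b hb =>
        hr a (Finset.mem_of_mem_erase (Finset.mem_filter.1 ha).1) b
          (Finset.mem_of_mem_erase (Finset.mem_filter.1 hb).1)
      refine ⟨l ++ [v], by simp [hl], ?_, List.pairwise_append.2 ⟨hlr, by simp, ?_⟩⟩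
      · intro a ha
        rcases List.mem_append.1 ha with ha | ha
        · exact Finset.mem_of_mem_erase (Finset.mem_filter.1 (hls a ha)).1
        · rw [List.mem_singleton.1 ha]; exact hv
      · intro a ha b hb
        obtain rfl := List.mem_singleton.1 hb
        obtain ⟨h1, h2⟩ := Finset.mem_filter.1 (hls a ha)
        obtain ⟨h3, h4⟩ := Finset.mem_erase.1 h1
        exact (hr a h4 b hv h3).resolve_right h2

/-- A maximality argument: if every family of `N` elements of `X` contains a pair related by `R`,
then fewer than `N` elements suffice to relate everything to. -/
theorem exists_finset_dominating {α : Type*} (X : Set α) (R : α → α → Prop)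
    (hrefl : ∀ a ∈ X, R a a) (hsymm : ∀ a b, R a b → R b a) (N : ℕ)
    (hN : ∀ S : Finset α, ↑S ⊆ X → N ≤ S.card → ∃ x ∈ S, ∃ y ∈ S, x ≠ y ∧ R x y) :
    ∃ S : Finset α, ↑S ⊆ X ∧ S.card < N ∧ ∀ a ∈ X, ∃ c ∈ S, R a c := by
  classical
  by_contra! hcon
  have key : ∀ k ≤ N, ∃ S : Finset α, ↑S ⊆ X ∧ S.card = k ∧
      ∀ x ∈ S, ∀ y ∈ S, x ≠ y → ¬ R x y := by
    intro k hk
    induction k with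
    | zero => exact ⟨∅, by simp, rfl, by simp⟩
    | succ k ih =>
      obtain ⟨S, hSX, hSk, hS⟩ := ih (by omega)
      obtain ⟨a, ha, haS⟩ := hcon S hSX (by omega)
      refine ⟨insert a S, ?_, ?_, ?_⟩
      · rw [Finset.coe_insert]; exact Set.insert_subset ha hSX
      · rw [Finset.card_insert_of_notMem fun h => haS a h (hrefl a ha), hSk]
      · intro x hx y hy hxy
        rcases Finset.mem_insert.1 hx with rfl | hx' <;>
          rcases Finset.mem_insert.1 hy with rfl | hy'
        · exact absurd rfl hxy
        · exact haS y hy'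
        · exact fun h => haS x hx' (hsymm _ _ h)
        · exact hS x hx' y hy' hxy
  obtain ⟨S, hSX, hSN, hS⟩ := key N le_rfl
  obtain ⟨x, hx, y, hy, hxy, h⟩ := hN S hSX hSN.ge
  exact hS x hx y hy hxy h

end Recurrence

/-! ### Packing with respect to a rough measure -/

section Packing

variable {G : Type w} [Group G] {𝒜 : Set (Set G)} (h𝒜 : IsRecurrenceAlgebra 𝒜)
  {W : Set G} {μ : Set G → ℝ≥0∞} (hμ : IsRoughMeasure 𝒜 W μ)
include h𝒜 hμ

/-- Additivity gives μ ∅ = μ ∅ + μ ∅; a set of finite measure is needed to exclude μ ∅ = ∞. -/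
theorem IsRoughMeasure.measure_empty {X : Set G} (hX : X ∈ 𝒜) (hfin : μ X ≠ ∞) : μ ∅ = 0 := by
  have h1 : μ ∅ ≠ ∞ :=
    ne_top_of_le_ne_top hfin (hμ.mono _ h𝒜.empty _ hX (Set.empty_subset _))
  have h2 := hμ.union_eq ∅ h𝒜.empty ∅ h𝒜.empty (by simp)
  rw [Set.union_empty] at h2
  by_contra h0
  exact (ENNReal.lt_add_right h1 h0).ne h2

theorem IsRoughMeasure.le_inter_add_diff {X Y : Set G} (hX : X ∈ 𝒜) (hY : Y ∈ 𝒜) :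
    μ X ≤ μ (X ∩ Y) + μ (X \ Y) := by
  conv_lhs => rw [← Set.inter_union_sdiff X Y]
  exact hμ.union_le _ (h𝒜.inter _ hX _ hY) _ (h𝒜.diff _ hX _ hY)

/-- Removing the thickened set Y W, not just Y, leaves a set to which rough additivity applies. -/
theorem IsRoughMeasure.diff_mul_add_le (hW : W ∈ 𝒜) {X Y : Set G} (hX : X ∈ 𝒜) (hY : Y ∈ 𝒜)
    (hYX : Y ⊆ X) : μ (X \ (Y * W)) + μ Y ≤ μ X := by
  have hd := h𝒜.diff _ hX _ (h𝒜.mul _ hY _ hW)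
  rw [← hμ.union_eq _ hd _ hY (by simp)]
  exact hμ.mono _ (h𝒜.union _ hd _ hY) _ hX (Set.union_subset Set.sdiff_subset hYX)

/-- The translates are added from the end of the list. Each one meets the W-thickening of the union
of the later ones in measure at most n s by subadditivity, and the rest of it counts additively. -/
theorem IsRoughMeasure.packing (hinv : ∀ g : G, ∀ X ∈ 𝒜, μ (g • X) = μ X) (hW : W ∈ 𝒜)
    (hempty : μ ∅ = 0) {B Z : Set G} (hB : B ∈ 𝒜) (hZ : Z ∈ 𝒜) (n : ℕ) (s : ℝ≥0∞) (l : List G)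
    (hn : l.length ≤ n) (hl : l.Pairwise fun x y => μ (x • B ∩ y • (B * W)) ≤ s)
    (hBZ : ∀ x ∈ l, x • B ⊆ Z) :
    l.length * μ B ≤ μ Z + l.length * (n * s) := by
  let V : List G → Set G := fun l => l.foldr (fun x Z => x • B ∪ Z) ∅
  have hV : ∀ l, V l ∈ 𝒜 := by
    intro l
    induction l with
    | nil => exact h𝒜.empty
    | cons x l ih => exact h𝒜.union _ (h𝒜.smul _ _ hB) _ ih
  have hVZ : ∀ l : List G, (∀ x ∈ l, x • B ⊆ Z) → V l ⊆ Z := by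
    intro l hl
    induction l with
    | nil => exact Set.empty_subset _
    | cons x l ih =>
      exact Set.union_subset (hl x (by simp)) (ih fun y hy => hl y (by simp [hy]))
  have hsum : ∀ (x : G) (l : List G), (∀ y ∈ l, μ (x • B ∩ y • (B * W)) ≤ s) →
      μ (x • B ∩ (V l * W)) ≤ l.length * s := by
    intro x l hl
    induction l with
    | nil => simp [V, hempty]
    | cons y l ih =>
      have h1 : x • B ∩ (V (y :: l) * W) =
          (x • B ∩ y • (B * W)) ∪ (x • B ∩ (V l * W)) := by
        rw [← Set.inter_union_distrib_left]
        congr 1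
        show (y • B ∪ V l) * W = _
        rw [Set.union_mul, smul_mul_assoc]
      rw [h1]
      have hxB := h𝒜.smul x _ hB
      refine (hμ.union_le _ (h𝒜.inter _ hxB _ (h𝒜.smul _ _ (h𝒜.mul _ hB _ hW))) _
        (h𝒜.inter _ hxB _ (h𝒜.mul _ (hV l) _ hW))).trans ?_
      rw [List.length_cons, Nat.cast_succ, add_mul, one_mul, add_comm]
      exact add_le_add (ih fun z hz => hl z (by simp [hz])) (hl y (by simp))
  have main : ∀ l : List G, l.length ≤ n → l.Pairwise (fun x y => μ (x • B ∩ y • (B * W)) ≤ s) →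
      l.length * μ B ≤ μ (V l) + l.length * (n * s) := by
    intro l hn hl
    induction l with
    | nil => simp
    | cons x l ih =>
      obtain ⟨hx, hl⟩ := List.pairwise_cons.1 hl
      have hn' : l.length ≤ n := by simp at hn; omega
      have hxB := h𝒜.smul x _ hB
      have hVW := h𝒜.mul _ (hV l) _ hW
      have h1 : μ B ≤ n * s + μ (x • B \ (V l * W)) := by
        rw [← hinv x B hB]
        refine (IsRoughMeasure.le_inter_add_diff h𝒜 hμ hxB hVW).trans ?_
        gcongr
        exact (hsum x l hx).trans (by gcongr)
      have h2 : μ (x • B \ (V l * W)) + μ (V l) ≤ μ (V (x :: l)) := by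
        have hd := h𝒜.diff _ hxB _ hVW
        rw [← hμ.union_eq _ hd _ (hV l) (by simp)]
        exact hμ.mono _ (h𝒜.union _ hd _ (hV l)) _ (hV _)
          (Set.union_subset_union_left _ Set.sdiff_subset)
      rw [List.length_cons, Nat.cast_succ, add_mul, one_mul, add_mul, one_mul]
      calc _ ≤ (μ (V l) + l.length * (n * s)) + (n * s + μ (x • B \ (V l * W))) :=
            add_le_add (ih hn' hl) h1
        _ = (μ (x • B \ (V l * W)) + μ (V l)) + (l.length * (n * s) + n * s) := by ring
        _ ≤ _ := by gcongr
  refine (main l hn hl).trans ?_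
  gcongr
  exact hμ.mono _ (hV l) _ hZ (hVZ l hBZ)

/-- A set of measure at least `t` has, among any sufficiently many translates of it in a set of
finite measure, two which meet in large measure. -/
theorem IsRoughMeasure.exists_large_inter (hinv : ∀ g : G, ∀ X ∈ 𝒜, μ (g • X) = μ X)
    (hW : W ∈ 𝒜) {Z : Set G} (hZ : Z ∈ 𝒜) (hfin : μ Z ≠ ∞) {t : ℝ≥0∞} (ht : t ≠ 0) :
    ∃ N : ℕ, ∃ s : ℝ≥0∞, s ≠ 0 ∧ s ≤ t ∧ ∀ B ∈ 𝒜, t ≤ μ B → ∀ S : Finset G, N ≤ S.card →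
      (∀ x ∈ S, x • B ⊆ Z) → ∃ x ∈ S, ∃ y ∈ S, x ≠ y ∧
        s < μ (x • B ∩ y • (B * W)) ∧ s < μ (y • B ∩ x • (B * W)) := by
  have hempty := hμ.measure_empty h𝒜 hZ hfin
  -- If t = ∞, no translate of B fits into Z, so one translate is already contradictory.
  rcases eq_or_ne t ∞ with rfl | ht'
  · refine ⟨1, 1, one_ne_zero, le_top, fun B hB htB S hS hSZ => ?_⟩
    obtain ⟨x, hx⟩ : S.Nonempty := Finset.card_pos.1 hS
    refine absurd (top_le_iff.1 (htB.trans ?_)) hfin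
    rw [← hinv x B hB]
    exact hμ.mono _ (h𝒜.smul _ _ hB) _ hZ (hSZ x hx)
  obtain ⟨n, hn⟩ : ∃ n : ℕ, 2 * μ Z / t < n :=
    ENNReal.exists_nat_gt (ENNReal.div_ne_top (ENNReal.mul_ne_top (by simp) hfin) ht)
  have hn0 : (n : ℝ≥0∞) ≠ 0 := fun h => by simp [h] at hn
  have hnt : 2 * μ Z < n * t := by
    rwa [ENNReal.div_lt_iff (Or.inl ht) (Or.inl ht')] at hn
  refine ⟨2 ^ n, t / (2 * n), ?_, ?_, fun B hB htB S hS hSZ => ?_⟩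
  · exact ENNReal.div_ne_zero.2 ⟨ht, by finiteness⟩
  · refine ENNReal.div_le_of_le_mul (le_mul_of_one_le_right' ?_)
    have : n ≠ 0 := fun h => hn0 (by simp [h])
    exact_mod_cast (by omega : 1 ≤ 2 * n)
  by_contra! hcon
  -- If every pair fails in some direction, the failures form a tournament. A transitive part lists
  -- n translates with small overlaps in list order. Packing with s = t / (2n) then gives n t ≤ 2 μ
  -- Z, against the choice of n.
  obtain ⟨l, hl, hlS, hlr⟩ := exists_pairwise_list_of_tournament
    (fun x y => μ (x • B ∩ y • (B * W)) ≤ t / (2 * n)) n S hS (by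
      intro a ha b hb hab
      by_contra! h
      exact (hcon a ha b hb hab h.1).not_gt h.2)
  have := IsRoughMeasure.packing h𝒜 hμ hinv hW hempty hB hZ n _ l hl.le hlr
    fun x hx => hSZ x (hlS x hx)
  rw [hl] at this
  have h3 : (n : ℝ≥0∞) * (t / (2 * n)) = t / 2 := by
    rw [ENNReal.div_eq_inv_mul, ENNReal.div_eq_inv_mul,
      ENNReal.mul_inv (Or.inl (by simp)) (Or.inl (by simp)), mul_comm (2⁻¹) ((n : ℝ≥0∞)⁻¹),
      mul_assoc, ← mul_assoc, ENNReal.mul_inv_cancel hn0 (by simp), one_mul]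
  rw [h3] at this
  have h4 : n * t ≤ μ Z + n * (t / 2) := (by gcongr : n * t ≤ n * μ B).trans this
  have h5 : (n : ℝ≥0∞) * t = n * (t / 2) + n * (t / 2) := by
    rw [← mul_add, ENNReal.add_halves]
  rw [h5] at h4
  have h6 : (n : ℝ≥0∞) * (t / 2) ≤ μ Z :=
    (ENNReal.add_le_add_iff_right (by finiteness)).1 h4
  have h7 : n * t ≤ 2 * μ Z := by rw [h5, two_mul]; exact add_le_add h6 h6
  exact h7.not_gt hnt

end Packing

/-! ### Sets of large recurrence -/

section Step

variable {G : Type w} [Group G] {𝒜 : Set (Set G)} (h𝒜 : IsRecurrenceAlgebra 𝒜)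
  {W : Set G} {μ : Set G → ℝ≥0∞} (hμ : IsRoughMeasure 𝒜 W μ)
  (hinv : ∀ g : G, ∀ X ∈ 𝒜, μ (g • X) = μ X) (hW : W ∈ 𝒜) (hW1 : (1 : G) ∈ W)
  {A : Set G} (hA : A ∈ 𝒜) (hAs : IsSymmetricSubset A)
include h𝒜 hμ hinv hW hW1 hA hAs

/-- Sets of positive measure are recurrent. -/
theorem exists_forall_recurrent (hfin : μ (A ^ 2) ≠ ∞) (k : ℕ) (t : ℝ≥0∞) (ht : t ≠ 0) :
    ∃ l : List ℕ, l.length = k ∧ ∀ B ∈ 𝒜, B ⊆ A → t ≤ μ B → Recurrent A W l B := by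
  induction k generalizing t with
  | zero =>
    refine ⟨[], rfl, fun B hB hBA htB => ?_⟩
    rw [Recurrent, Set.nonempty_iff_ne_empty]
    rintro rfl
    rw [hμ.measure_empty h𝒜 (h𝒜.pow hA 2) hfin] at htB
    exact ht (by simpa using htB)
  | succ k ih =>
    -- N and s depend on t but not on B, so one list serves all B.
    obtain ⟨N, s, hs, hst, hN⟩ :=
      hμ.exists_large_inter h𝒜 hinv hW (h𝒜.pow hA 2) hfin ht
    obtain ⟨l, hl, hrec⟩ := ih s hs
    refine ⟨N :: l, by simp [hl], fun B hB hBA htB => ?_⟩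
    have hBW := h𝒜.mul _ hB _ hW
    have hinter : ∀ x y : G, μ (B ∩ (x⁻¹ * y) • (B * W)) = μ (x • B ∩ y • (B * W)) := by
      intro x y
      rw [← hinv x _ (h𝒜.inter _ hB _ (h𝒜.smul _ _ hBW)), Set.smul_set_inter, smul_smul,
        mul_inv_cancel_left]
    obtain ⟨S, hSA, hSN, hS⟩ := exists_finset_dominating A
      (fun x y => s ≤ μ (x • B ∩ y • (B * W)) ∧ s ≤ μ (y • B ∩ x • (B * W)))
      (fun a _ => by
        have : s ≤ μ (a • B ∩ a • (B * W)) := by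
          rw [Set.inter_eq_left.2, hinv a B hB]
          · exact hst.trans htB
          · gcongr; exact Set.subset_mul_left B hW1
        exact ⟨this, this⟩)
      (fun a b h => h.symm) N (fun S hSA hSN => by
        obtain ⟨x, hx, y, hy, hxy, h1, h2⟩ := hN B hB htB S hSN (fun x hx => by
          rw [pow_two, ← smul_eq_mul]
          exact (Set.smul_set_mono hBA).trans (Set.smul_set_subset_smul (hSA hx)))
        exact ⟨x, hx, y, hy, hxy, h1.le, h2.le⟩)
    -- Fewer than N centres are needed; the family is padded with 1 ∈ A.
    refine ⟨fun i => if h : i.1 < S.card then S.equivFin.symm ⟨i, h⟩ else 1, fun i => ?_,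
      fun a ha => ?_⟩
    · dsimp only
      split_ifs
      · exact hSA (Finset.coe_mem _)
      · exact hAs.1
    · obtain ⟨c, hc, h1, h2⟩ := hS a ha
      refine ⟨⟨S.equivFin ⟨c, hc⟩, (S.equivFin ⟨c, hc⟩).2.trans hSN⟩, ?_⟩
      simp only [Fin.is_lt, Fin.eta, Equiv.symm_apply_apply, dite_true]
      exact ⟨hrec _ (h𝒜.inter _ hB _ (h𝒜.smul _ _ hBW)) (Set.inter_subset_left.trans hBA)
          (by rwa [hinter]),
        hrec _ (h𝒜.inter _ hB _ (h𝒜.smul _ _ hBW)) (Set.inter_subset_left.trans hBA)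
          (by rwa [hinter])⟩

omit hμ hinv hW1 hA hAs in
/-- Energy decrement: passing to intersections with translates along recurrence times, one finds a
recurrent set for which this does not lower `Φ` much. -/
theorem exists_recurrent_stable (Φ : Set G → ℝ≥0∞) (ε : ℝ≥0∞) (l : List ℕ) :
    ∀ B ∈ 𝒜, B ⊆ A → Recurrent A W l B → Φ B < l.length * ε →
      ∃ B' ∈ 𝒜, B' ⊆ A ∧ ∃ N l', Recurrent A W (N :: l') B' ∧
        ∀ g ∈ recurrenceSet A W l' B', Φ B' ≤ Φ (B' ∩ g • (B' * W)) + ε := by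
  induction l with
  -- The decrement ends here at the latest: Φ B < 0 is impossible.
  | nil => intro B _ _ _ h; simp at h
  | cons N l ih =>
    intro B hB hBA hrec hΦ
    by_cases h : ∀ g ∈ recurrenceSet A W l B, Φ B ≤ Φ (B ∩ g • (B * W)) + ε
    · exact ⟨B, hB, hBA, N, l, hrec, h⟩
    · push Not at h
      obtain ⟨g, ⟨-, hg, -⟩, hlt⟩ := h
      refine ih _ (h𝒜.inter _ hB _ (h𝒜.smul _ _ (h𝒜.mul _ hB _ hW)))
        (Set.inter_subset_left.trans hBA) hg ?_
      have := hlt.trans hΦ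
      rw [List.length_cons, Nat.cast_succ, add_mul, one_mul] at this
      exact lt_of_add_lt_add_right this

end Step

/-! ### Generic sets with small powers, and finite covers -/

section Step

/-- Stability of the total energy gives stability of every summand, because no other summand can
compensate for a loss. -/
theorem le_add_of_sum_le_sum_add {ι : Type*} [DecidableEq ι] (s : Finset ι) (f g : ι → ℝ≥0∞)
    (hfg : ∀ i ∈ s, f i ≤ g i) (hg : ∀ i ∈ s, g i ≠ ∞) {ε : ℝ≥0∞}
    (h : ∑ i ∈ s, g i ≤ ∑ i ∈ s, f i + ε) {i : ι} (hi : i ∈ s) : g i ≤ f i + ε := by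
  rw [← Finset.add_sum_erase s g hi, ← Finset.add_sum_erase s f hi] at h
  have h1 : ∑ x ∈ s.erase i, f x ≤ ∑ x ∈ s.erase i, g x :=
    Finset.sum_le_sum fun x hx => hfg x (Finset.mem_of_mem_erase hx)
  have h2 : ∑ x ∈ s.erase i, g x ≠ ∞ :=
    ENNReal.sum_ne_top.2 fun x hx => hg x (Finset.mem_of_mem_erase hx)
  refine (ENNReal.add_le_add_iff_right h2).1 (h.trans ?_)
  rw [add_right_comm]
  gcongr

variable {G : Type w} [Group G] {𝒜 : Set (Set G)} (h𝒜 : IsRecurrenceAlgebra 𝒜)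
  {W : Set G} {μ : Set G → ℝ≥0∞} (hμ : IsRoughMeasure 𝒜 W μ)
  (hinv : ∀ g : G, ∀ X ∈ 𝒜, μ (g • X) = μ X) (hW : W ∈ 𝒜) (hW1 : (1 : G) ∈ W)
  {A : Set G} (hA : A ∈ 𝒜) (hAs : IsSymmetricSubset A)

theorem IsSymmetricSubset.inv_pow (hAs : IsSymmetricSubset A) (m : ℕ) : (A ^ m)⁻¹ = A ^ m := by
  rw [← _root_.inv_pow, ← hAs.2]

theorem IsSymmetricSubset.pow_mono (hAs : IsSymmetricSubset A) {m k : ℕ} (h : m ≤ k) :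
    A ^ m ⊆ A ^ k :=
  Set.pow_right_monotone hAs.1 h

/-- The sets used to compare translates of `B * A`. -/
def thickening (A : Set G) (V : ℕ → Set G) (i : ℕ) (B : Set G) : Set G :=
  B * (A * V i) ∩ A ^ (2 + 2 * i)

theorem thickening_mono (A : Set G) (V : ℕ → Set G) (i : ℕ) {B C : Set G} (h : B ⊆ C) :
    thickening A V i B ⊆ thickening A V i C := by
  unfold thickening; gcongr

/-- A point of the second set lies in g B W (A V_i) W, and `hstep` absorbs both factors W into
V_{i+1}. Translating by g⁻¹ ∈ A² costs two factors in the truncation, whence the exponent 2 + 2i. -/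
theorem thickening_inter_subset {V : ℕ → Set G} {i : ℕ}
    (hstep : W * (A * V i) * W ⊆ A * V (i + 1)) {B : Set G} {g : G} (hg : g⁻¹ ∈ A ^ 2) :
    thickening A V i B ∩ (thickening A V i (B ∩ g • (B * W)) * W) ⊆
      g • thickening A V (i + 1) B := by
  rintro _ ⟨⟨-, hx⟩, y, ⟨⟨d, ⟨-, hd⟩, z, hz, rfl⟩, -⟩, w, hw, rfl⟩
  obtain ⟨_, ⟨b, hb, u, hu, rfl⟩, rfl⟩ := hd
  refine ⟨b * (u * z * w), ⟨⟨b, hb, _, hstep ⟨u * z, ⟨u, hu, z, hz, rfl⟩, w, hw, rfl⟩, rfl⟩, ?_⟩,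
    ?_⟩
  · have h := Set.mul_mem_mul hg hx
    rw [← pow_add] at h
    convert h using 1
    · congr 1; omega
    · simp only [smul_eq_mul]; group
  · simp only [smul_eq_mul]; group

include h𝒜 hμ hinv hW hW1 hA hAs

/-- The set of recurrence times of a suitable recurrent set has small powers. -/
theorem exists_generic_pow_subset {V : ℕ → Set G} {p : ℕ} (hV : ∀ i, V i ∈ 𝒜)
    (hV1 : (1 : G) ∈ V 0) (hstep : ∀ i < p, W * (A * V i) * W ⊆ A * V (i + 1))
    (hfin : μ (A ^ (2 + 2 * p)) ≠ ∞) (h0 : μ A ≠ 0) :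
    ∃ S ∈ 𝒜, IsSymmetricSubset S ∧ S ⊆ A ^ 2 ∧ (∃ F : Set G, F.Finite ∧ A ⊆ F * S) ∧
      S ^ p ⊆ A ^ 2 * V 0 * ((V p)⁻¹ * A ^ 2) := by
  classical
  have hApow : ∀ m ≤ 2 + 2 * p, μ (A ^ m) ≠ ∞ := fun m hm => ne_top_of_le_ne_top hfin
    (hμ.mono _ (h𝒜.pow hA _) _ (h𝒜.pow hA _) (hAs.pow_mono hm))
  have hA1 : μ A ≠ ∞ := by simpa using hApow 1 (by omega)
  have hempty := hμ.measure_empty h𝒜 hA hA1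
  -- The truncation keeps all these sets inside A ^ (2 + 2p), hence of finite measure.
  let E := thickening A V
  have hE : ∀ i B, B ∈ 𝒜 → E i B ∈ 𝒜 := fun i B hB =>
    h𝒜.inter _ (h𝒜.mul _ hB _ (h𝒜.mul _ hA _ (hV i))) _ (h𝒜.pow hA _)
  have hEfin : ∀ i ≤ p, ∀ B ∈ 𝒜, μ (E i B) ≠ ∞ := fun i hi B hB =>
    ne_top_of_le_ne_top (hApow (2 + 2 * i) (by omega))
      (hμ.mono _ (hE i B hB) _ (h𝒜.pow hA _) Set.inter_subset_right)
  -- Small enough that p losses of ε do not exhaust μ A.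
  set ε : ℝ≥0∞ := μ A / (p + 1) with hε
  have hε0 : ε ≠ 0 := ENNReal.div_ne_zero.2 ⟨h0, by finiteness⟩
  have hpε : p * ε < μ A := by
    have h1 : (p + 1) * ε = μ A := ENNReal.mul_div_cancel (by simp) (by finiteness)
    have h2 : ε ≠ ∞ := ENNReal.div_ne_top hA1 (by simp)
    rw [← h1, add_mul, one_mul]
    exact ENNReal.lt_add_right (by finiteness) hε0
  let Φ : Set G → ℝ≥0∞ := fun B => ∑ i ∈ Finset.range (p + 1), μ (E i B)
  -- A list of length k leaves enough recurrence for all energy drops of size ε that can start from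
  -- Φ A.
  obtain ⟨k, hk⟩ : ∃ k : ℕ, Φ A / ε < k := ENNReal.exists_nat_gt (ENNReal.div_ne_top
    (ENNReal.sum_ne_top.2 fun i hi => hEfin i (by simpa [Nat.lt_succ_iff] using hi) A hA) hε0)
  have hk : Φ A < k * ε := by
    rwa [ENNReal.div_lt_iff (Or.inl hε0) (Or.inl (ENNReal.div_ne_top hA1 (by simp)))] at hk
  obtain ⟨l, hl, hrec⟩ := exists_forall_recurrent h𝒜 hμ hinv hW hW1 hA hAs
    (hApow 2 (by omega)) k (μ A) h0
  obtain ⟨B, hB, hBA, N, l', hBrec, hBstab⟩ := exists_recurrent_stable (W := W) h𝒜 hW Φ ε l A hA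
    subset_rfl (hrec A hA subset_rfl le_rfl) (by rwa [hl])
  have hAinv : ∀ a ∈ A, a⁻¹ ∈ A := fun a ha => by rw [hAs.2]; simpa using ha
  set S := recurrenceSet A W l' B with hS
  have hSinv : ∀ g ∈ S, g⁻¹ ∈ S := by
    rintro g ⟨h1, h2, h3⟩
    refine ⟨?_, h3, by rwa [inv_inv]⟩
    rw [← hAs.inv_pow]
    simpa using h1
  have hstable : ∀ g ∈ S, ∀ i < p, μ (E i B \ (g • E (i + 1) B)) ≤ ε := by
    intro g hg i hi
    have hgi := (hSinv g hg).1
    set D := B ∩ g • (B * W) with hD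
    have hD𝒜 : D ∈ 𝒜 := h𝒜.inter _ hB _ (h𝒜.smul _ _ (h𝒜.mul _ hB _ hW))
    have h1 : μ (E i B) ≤ μ (E i D) + ε := by
      refine le_add_of_sum_le_sum_add (Finset.range (p + 1)) (fun i => μ (E i D))
        (fun i => μ (E i B)) (fun i _ => ?_) (fun i hi => ?_) (hBstab g hg)
        (Finset.mem_range.2 (by omega))
      · exact hμ.mono _ (hE i D hD𝒜) _ (hE i B hB) (thickening_mono A V i Set.inter_subset_left)
      · exact hEfin i (by simpa [Nat.lt_succ_iff] using hi) B hB
    have h2 := hμ.diff_mul_add_le h𝒜 hW (hE i B hB) (hE i D hD𝒜)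
      (thickening_mono A V i Set.inter_subset_left)
    have h3 : μ (E i B \ (E i D * W)) ≤ ε := by
      rw [← ENNReal.add_le_add_iff_right (hEfin i hi.le D hD𝒜), add_comm ε]
      exact h2.trans h1
    refine le_trans (hμ.mono _ (h𝒜.diff _ (hE i B hB) _ (h𝒜.smul _ _ (hE _ B hB))) _
      (h𝒜.diff _ (hE i B hB) _ (h𝒜.mul _ (hE i D hD𝒜) _ hW)) ?_) h3
    rintro x ⟨hx, hxg⟩
    exact ⟨hx, fun hxD => hxg (thickening_inter_subset (hstep i hi) hgi ⟨hx, hxD⟩)⟩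
  -- Appending a factor k ∈ S loses at most h (E_i B \ k E_{i+1} B), of measure at most ε by
  -- `hstable` and invariance.
  have hchain : ∀ i ≤ p, ∀ g ∈ S ^ i, μ (E 0 B) ≤ μ (E 0 B ∩ g • E i B) + i * ε := by
    intro i hi
    induction i with
    | zero =>
      intro g hg
      rw [pow_zero, Set.mem_one] at hg
      simp [hg]
    | succ i ih =>
      intro g hg
      rw [pow_succ] at hg
      obtain ⟨h, hh, k, hk, rfl⟩ := hg
      have hE0 := hE 0 B hB
      have hEi := hE i B hB
      have hEk := h𝒜.smul k _ (hE (i + 1) B hB)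
      have h1 : E 0 B ∩ h • E i B ⊆
          (E 0 B ∩ (h * k) • E (i + 1) B) ∪ h • (E i B \ k • E (i + 1) B) := by
        rintro x ⟨hx, y, hy, rfl⟩
        by_cases hyk : y ∈ k • E (i + 1) B
        · left
          refine ⟨hx, ?_⟩
          rw [mul_smul]
          exact Set.smul_mem_smul_set hyk
        · exact Or.inr (Set.smul_mem_smul_set ⟨hy, hyk⟩)
      have h2 := h𝒜.inter _ hE0 _ (h𝒜.smul (h * k) _ (hE (i + 1) B hB))
      have h3 := h𝒜.smul h _ (h𝒜.diff _ hEi _ hEk)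
      calc μ (E 0 B) ≤ μ (E 0 B ∩ h • E i B) + i * ε := ih (by omega) h hh
        _ ≤ (μ (E 0 B ∩ (h * k) • E (i + 1) B) + μ (h • (E i B \ k • E (i + 1) B))) + i * ε := by
          gcongr
          exact (hμ.mono _ (h𝒜.inter _ hE0 _ (h𝒜.smul _ _ hEi)) _ (h𝒜.union _ h2 _ h3) h1).trans
            (hμ.union_le _ h2 _ h3)
        _ ≤ (μ (E 0 B ∩ (h * k) • E (i + 1) B) + ε) + i * ε := by
          gcongr
          rw [hinv h _ (h𝒜.diff _ hEi _ hEk)]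
          exact hstable k hk i (by omega)
        _ = _ := by push_cast; ring
  have hbase : μ A ≤ μ (E 0 B) := by
    obtain ⟨b, hb⟩ := hBrec.nonempty hAs.1
    rw [← hinv b A hA]
    refine hμ.mono _ (h𝒜.smul _ _ hA) _ (hE 0 B hB) ?_
    rintro _ ⟨a, ha, rfl⟩
    refine ⟨⟨b, hb, a, ⟨a, ha, 1, hV1, mul_one a⟩, rfl⟩, ?_⟩
    rw [mul_zero, add_zero, pow_two]
    exact ⟨b, hBA hb, a, ha, rfl⟩
  refine ⟨S, h𝒜.recurrenceSet A hA W hW B hB l', ⟨⟨?_, ?_, ?_⟩, ?_⟩, fun g hg => hg.1, ?_, ?_⟩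
  · rw [pow_two]; exact ⟨1, hAs.1, 1, hAs.1, mul_one 1⟩
  · rw [one_smul, Set.inter_eq_left.2 (Set.subset_mul_left B hW1)]
    exact hBrec.tail hAs.1
  · rw [inv_one, one_smul, Set.inter_eq_left.2 (Set.subset_mul_left B hW1)]
    exact hBrec.tail hAs.1
  · ext g
    exact ⟨fun h => hSinv g h, fun h => by simpa using hSinv _ h⟩
  -- Genericity is the outermost level of recurrence: its N centres give the covering translates of
  -- S.
  · obtain ⟨c, hc, hcov⟩ := hBrec
    refine ⟨Set.range c, Set.finite_range c, fun a ha => ?_⟩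
    obtain ⟨i, h1, h2⟩ := hcov a ha
    refine ⟨c i, ⟨i, rfl⟩, (c i)⁻¹ * a, ⟨?_, h2, ?_⟩, by simp⟩
    · rw [pow_two]; exact ⟨_, hAinv _ (hc i), a, ha, rfl⟩
    · rwa [mul_inv_rev, inv_inv]
  · intro g hg
    have h1 := hchain p le_rfl g hg
    have h2 : (E 0 B ∩ g • E p B).Nonempty := by
      rw [Set.nonempty_iff_ne_empty]
      intro h
      rw [h, hempty, zero_add] at h1
      exact (hpε.trans_le hbase).not_ge h1
    obtain ⟨x, ⟨⟨b, hb, _, ⟨a, ha, v, hv, rfl⟩, rfl⟩, -⟩, y,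
      ⟨⟨b', hb', _, ⟨a', ha', v', hv', rfl⟩, rfl⟩, -⟩, hxy⟩ := h2
    refine ⟨b * a * v, ⟨b * a, ?_, v, hv, rfl⟩, v'⁻¹ * (a'⁻¹ * b'⁻¹), ⟨v'⁻¹, by simpa using hv', _,
      ?_, rfl⟩, ?_⟩
    · rw [pow_two]; exact ⟨b, hBA hb, a, ha, rfl⟩
    · rw [pow_two]; exact ⟨_, hAinv _ ha', _, hAinv _ (hBA hb'), rfl⟩
    · simp only [smul_eq_mul] at hxy ⊢
      rw [mul_assoc b a v, ← hxy]
      group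

omit hW1 hA hAs in
/-- Packing: a set is covered by finitely many translates of `X * W * X⁻¹` if its product with `X`
has finite measure. -/
theorem exists_finite_cover (hWs : W = W⁻¹) {X : Set G} (hX : X ∈ 𝒜) (hX1 : (1 : G) ∈ X)
    (hW1 : (1 : G) ∈ W) (h0 : μ X ≠ 0) {Y Z : Set G}
    (hZ : Z ∈ 𝒜) (hZfin : μ Z ≠ ∞) (hYX : Y * X ⊆ Z) :
    ∃ F : Set G, F.Finite ∧ F ⊆ Y ∧ Y ⊆ F * (X * W * X⁻¹) := by
  -- Only nonemptiness of the overlaps is used, so the value of s is irrelevant.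
  obtain ⟨N, s, -, -, hN⟩ := hμ.exists_large_inter h𝒜 hinv hW hZ hZfin h0
  have hempty := hμ.measure_empty h𝒜 hZ hZfin
  obtain ⟨F, hFY, -, hF⟩ := exists_finset_dominating Y
    (fun x y => (x • X ∩ y • (X * W)).Nonempty ∨ (y • X ∩ x • (X * W)).Nonempty)
    (fun a _ => Or.inl ⟨a, ⟨1, hX1, mul_one a⟩, 1, ⟨1, hX1, 1, hW1, mul_one 1⟩, mul_one a⟩)
    (fun a b h => h.symm) N (fun S hSY hSN => by
      obtain ⟨x, hx, y, hy, hxy, h, -⟩ := hN X hX le_rfl S hSN fun x hx => by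
        refine subset_trans ?_ hYX
        rw [← smul_eq_mul]
        exact Set.smul_set_subset_smul (hSY hx)
      refine ⟨x, hx, y, hy, hxy, Or.inl (Set.nonempty_iff_ne_empty.2 fun he => ?_)⟩
      rw [he, hempty] at h
      exact not_lt_zero h)
  refine ⟨F, F.finite_toSet, hFY, fun a ha => ?_⟩
  obtain ⟨c, hc, h⟩ := hF a ha
  refine ⟨c, hc, c⁻¹ * a, ?_, by simp⟩
  rcases h with ⟨_, ⟨x, hx, rfl⟩, _, ⟨y, hy, w, hw, rfl⟩, h⟩ |
    ⟨_, ⟨x, hx, rfl⟩, _, ⟨y, hy, w, hw, rfl⟩, h⟩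
  · refine ⟨y * w, ⟨y, hy, w, hw, rfl⟩, x⁻¹, by simpa using hx, ?_⟩
    simp only [smul_eq_mul] at h ⊢
    rw [eq_inv_mul_iff_mul_eq, ← mul_assoc, h, mul_inv_cancel_right]
  · refine ⟨x * w⁻¹, ⟨x, hx, w⁻¹, by rw [hWs]; simpa using hw, rfl⟩, y⁻¹, by simpa using hy, ?_⟩
    simp only [smul_eq_mul] at h ⊢
    rw [eq_inv_mul_iff_mul_eq, ← mul_assoc, ← mul_assoc, ← h]
    group

end Step

namespace MSLanguage

/-! ### First-order definability of recurrence -/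

section Algebra

variable {L : MSLanguage.{u, v, v'}} {M : L.Sorts → Type w} [L.Structure M]
variable {n : ℕ} {σ : Fin n → L.Sorts} {G : Set (∀ i, M (σ i))} [Group G]

variable (L) in
/-- A family of subsets of `G` with parameters indexed by `ι` is uniformly definable. -/
def DefFamily {ι : Type} (B : (ι → G) → Set G) : Prop :=
  L.DefRel (fun g : ι ⊕ Unit → G => g (Sum.inr ()) ∈ B (g ∘ Sum.inl))

variable (hG : L.IsDefinableGroup G)
include hG

theorem DefFamily.mem {ι κ : Type} [Finite ι] [Finite κ] {B : (ι → G) → Set G}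
    (hB : L.DefFamily B) (e : ι → κ) {t : (κ → G) → G} (ht : L.DefFun t) :
    L.DefRel (fun g : κ → G => t g ∈ B (g ∘ e)) :=
  DefRel.comp hG hB (t := Sum.elim (fun i g => g (e i)) fun _ => t) (by
    rintro (i | _)
    · exact DefFun.var hG _
    · exact ht)

theorem DefFamily.inter_smul {ι κ : Type} [Finite ι] [Finite κ] {B : (ι → G) → Set G}
    (hB : L.DefFamily B) {U : Set G} (hU : U ∈ L.definableSubsets G) (e : ι → κ)
    {t : (κ → G) → G} (ht : L.DefFun t) :
    L.DefFamily (fun g : κ → G => B (g ∘ e) ∩ t g • (B (g ∘ e) * U)) := by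
  have ht' : L.DefFun (fun g : (κ ⊕ Unit) ⊕ Unit → G => t (g ∘ Sum.inl ∘ Sum.inl)) :=
    DefRel.subst hG.definable_carrier (ι := ((κ ⊕ Unit) ⊕ Unit) ⊕ Unit) ht
      (Sum.elim (fun i => Sum.inl (Sum.inl (Sum.inl (Sum.inl i)))) fun _ => Sum.inl (Sum.inr ()))
  have h1 := hB.mem hG (fun i => Sum.inl (e i)) (DefFun.var hG (Sum.inr () : κ ⊕ Unit))
  have h2 := (DefRel.mem hG hU (DefFun.var hG (Sum.inr () : (κ ⊕ Unit) ⊕ Unit))).and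
    (hB.mem hG (fun i => Sum.inl (Sum.inl (e i))) (((ht'.inv hG).mul hG
      (DefFun.var hG (Sum.inl (Sum.inr ())))).mul hG ((DefFun.var hG (Sum.inr ())).inv hG)))
  have h3 := h1.and (DefRel.exists_one (R := fun (g : κ ⊕ Unit → G) u => u ∈ U ∧
    (t (g ∘ Sum.inl))⁻¹ * g (Sum.inr ()) * u⁻¹ ∈ B (fun i => g (Sum.inl (e i)))) h2)
  unfold DefFamily
  convert h3 using 2 with g
  refine and_congr_right fun _ => ⟨?_, ?_⟩
  · rintro ⟨_, ⟨b, hb, u, hu, rfl⟩, h⟩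
    refine ⟨u, hu, ?_⟩
    have h4 : (t (g ∘ Sum.inl))⁻¹ * g (Sum.inr ()) * u⁻¹ = b := by
      rw [← h]
      simp [mul_assoc]
    rw [h4]
    exact hb
  · rintro ⟨u, hu, hb⟩
    refine ⟨_, ⟨_, hb, u, hu, rfl⟩, ?_⟩
    simp [mul_assoc]

/-- Each list entry adds one block of quantifiers over elements of G. The induction is over
uniformly definable families, since the inner sets depend on the newly quantified elements. -/
theorem defRel_recurrent {A U : Set G} (hA : A ∈ L.definableSubsets G)
    (hU : U ∈ L.definableSubsets G) (l : List ℕ) {ι : Type} [Finite ι] {B : (ι → G) → Set G}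
    (hB : L.DefFamily B) : L.DefRel (fun g : ι → G => Recurrent A U l (B g)) := by
  induction l generalizing ι with
  | nil => exact DefRel.exists_one hB
  | cons N l ih =>
    have h1 : ∀ i, L.DefRel (fun g : (ι ⊕ Fin N) ⊕ Unit → G =>
        Recurrent A U l (B (g ∘ Sum.inl ∘ Sum.inl) ∩
          ((g (Sum.inr ()))⁻¹ * g (Sum.inl (Sum.inr i))) • (B (g ∘ Sum.inl ∘ Sum.inl) * U)) ∧
        Recurrent A U l (B (g ∘ Sum.inl ∘ Sum.inl) ∩
          ((g (Sum.inl (Sum.inr i)))⁻¹ * g (Sum.inr ())) • (B (g ∘ Sum.inl ∘ Sum.inl) * U))) :=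
      fun i => DefRel.and
        (ih (hB.inter_smul hG hU _
          (((DefFun.var hG _).inv hG).mul hG (DefFun.var hG _))))
        (ih (hB.inter_smul hG hU _
          (((DefFun.var hG _).inv hG).mul hG (DefFun.var hG _))))
    have h2 := DefRel.forall_block hG.definable_carrier (DefRel.imp hG.definable_carrier
      (DefRel.mem hG hA (DefFun.var hG (Sum.inr () : (ι ⊕ Fin N) ⊕ Unit)))
      (DefRel.any hG.definable_carrier h1))
    have h3 := DefRel.exists_block ((DefRel.all hG.definable_carrier fun i : Fin N =>
      DefRel.mem hG hA (DefFun.var hG (Sum.inr i : ι ⊕ Fin N))).and h2)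
    convert h3 using 2 with g
    rw [Recurrent]
    refine exists_congr fun c => and_congr_right fun _ => ⟨fun h a ha => h (a ()) ha,
      fun h a ha => h (fun _ => a) ha⟩

theorem isRecurrenceAlgebra_definableSubsets : IsRecurrenceAlgebra (L.definableSubsets G) := by
  have hv := DefFun.var hG (ι := Unit) ()
  have hmem : ∀ {X : Set G} {t : (Unit → G) → G}, X ∈ L.definableSubsets G → L.DefFun t →
      L.DefRel (fun g : Unit → G => t g ∈ X) := fun hX ht => DefRel.mem hG hX ht
  constructor
  · refine defRel_mem_iff.1 ?_
    have := (defRel_eq hG).comp hG (t := ![fun g : Unit → G => g (), fun _ => 1]) (by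
      intro k
      fin_cases k
      · exact hv
      · exact DefFun.const hG 1)
    exact this
  · refine defRel_mem_iff.1 ?_
    simpa using (DefRel.true hG.definable_carrier (ι := Unit)).not hG.definable_carrier
  · exact fun X hX Y hY => defRel_mem_iff.1 ((hmem hX hv).and (hmem hY hv))
  · exact fun X hX Y hY =>
      defRel_mem_iff.1 (DefRel.or hG.definable_carrier (hmem hX hv) (hmem hY hv))
  · exact fun X hX Y hY =>
      defRel_mem_iff.1 ((hmem hX hv).and ((hmem hY hv).not hG.definable_carrier))
  · intro X hX Y hY
    refine defRel_mem_iff.1 ?_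
    have := DefRel.exists_one (R := fun (g : Unit → G) (a : G) => a ∈ X ∧ a⁻¹ * g () ∈ Y)
      ((DefRel.mem hG hX (DefFun.var hG (Sum.inr () : Unit ⊕ Unit))).and
        (DefRel.mem hG hY (((DefFun.var hG (Sum.inr () : Unit ⊕ Unit)).inv hG).mul hG
          (DefFun.var hG (Sum.inl ())))))
    convert this using 2 with g
    constructor
    · rintro ⟨a, ha, b, hb, h⟩
      exact ⟨a, ha, by rw [← h]; simpa using hb⟩
    · rintro ⟨a, ha, hb⟩
      exact ⟨a, ha, _, hb, by simp⟩
  · intro c X hX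
    refine defRel_mem_iff.1 ?_
    convert hmem hX (((DefFun.const hG c⁻¹)).mul hG hv) using 2 with g
    rw [Set.mem_smul_set_iff_inv_smul_mem, smul_eq_mul]
  · intro c X hX
    exact defRel_mem_iff.1 (hmem (X := X) hX (((DefFun.const hG c⁻¹).mul hG hv).mul hG
      (DefFun.const hG c)))
  · intro A hA U hU B hB l
    have hfam : L.DefFamily (fun _ : Unit → G => B) :=
      DefRel.mem hG hB (DefFun.var hG _)
    refine defRel_mem_iff.1 ((hmem ?_ hv).and
      ((defRel_recurrent hG hA hU l (hfam.inter_smul hG hU id hv)).and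
        (defRel_recurrent hG hA hU l (hfam.inter_smul hG hU id (hv.inv hG)))))
    refine defRel_mem_iff.1 ?_
    have := DefRel.exists_one (R := fun (g : Unit → G) (a : G) => a ∈ A ∧ a⁻¹ * g () ∈ A)
      ((DefRel.mem hG hA (DefFun.var hG (Sum.inr () : Unit ⊕ Unit))).and
        (DefRel.mem hG hA (((DefFun.var hG (Sum.inr () : Unit ⊕ Unit)).inv hG).mul hG
          (DefFun.var hG (Sum.inl ())))))
    convert this using 2 with g
    rw [pow_two]
    constructor
    · rintro ⟨a, ha, b, hb, h⟩
      exact ⟨a, ha, by rw [← h]; simpa using hb⟩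
    · rintro ⟨a, ha, hb⟩
      exact ⟨a, ha, _, hb, by simp⟩

end Algebra

end MSLanguage

/-! ### Thickening sequences -/

section Thickening

variable {G : Type w} [Group G] {𝒜 : Set (Set G)} {A : Set G} {T : ℕ → Set G}

namespace IsThickeningSequence

variable (hT : IsThickeningSequence 𝒜 A T)
include hT

theorem one_mem (i : ℕ) : (1 : G) ∈ T i := (hT.symmetric i).1

theorem inv_mem {i : ℕ} {t : G} (ht : t ∈ T i) : t⁻¹ ∈ T i := by
  rw [(hT.symmetric i).2]; simpa using ht

theorem mul_mem {i : ℕ} {s t : G} (hs : s ∈ T (i + 1)) (ht : t ∈ T (i + 1)) : s * t ∈ T i :=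
  hT.sq_subset i (by rw [pow_two]; exact Set.mul_mem_mul hs ht)

theorem antitone : Antitone T :=
  antitone_nat_of_succ_le fun i t ht => by simpa using hT.mul_mem ht (hT.one_mem (i + 1))

/-- Each factor from A costs one index of T. -/
theorem conj_mem {d i : ℕ} {x t : G} (hx : x ∈ A ^ d) (ht : t ∈ T (i + d)) :
    x⁻¹ * t * x ∈ T i := by
  induction d generalizing i x with
  | zero =>
    rw [pow_zero, Set.mem_one] at hx
    simpa [hx] using ht
  | succ d ih =>
    rw [pow_succ] at hx
    obtain ⟨y, hy, a, ha, rfl⟩ := hx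
    have h1 : y⁻¹ * t * y ∈ T (i + 1) := ih hy (by rwa [add_assoc, add_comm 1 d])
    convert hT.conj_subset i a ha _ h1 using 1
    simp [mul_assoc]

theorem iInter_mul_mem {s t : G} (hs : s ∈ ⋂ i, T i) (ht : t ∈ ⋂ i, T i) : s * t ∈ ⋂ i, T i :=
  Set.mem_iInter.2 fun i => hT.mul_mem (Set.mem_iInter.1 hs (i + 1)) (Set.mem_iInter.1 ht (i + 1))

theorem iInter_inv_mem {t : G} (ht : t ∈ ⋂ i, T i) : t⁻¹ ∈ ⋂ i, T i :=
  Set.mem_iInter.2 fun i => hT.inv_mem (Set.mem_iInter.1 ht i)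

theorem iInter_conj_mem {d : ℕ} {x t : G} (hx : x ∈ A ^ d) (ht : t ∈ ⋂ i, T i) :
    x⁻¹ * t * x ∈ ⋂ i, T i :=
  Set.mem_iInter.2 fun i => hT.conj_mem hx (Set.mem_iInter.1 ht (i + d))

/-- T_∞ is a group normalised by A, so its factors can be moved to the right. -/
theorem exists_mem_pow_mul (hAs : IsSymmetricSubset A) {x : G}
    (hx : x ∈ Subgroup.closure (A * ⋂ i, T i)) : ∃ m, x ∈ A ^ m * ⋂ i, T i := by
  induction hx using Subgroup.closure_induction with
  | mem x hx => exact ⟨1, by rwa [pow_one]⟩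
  | one => exact ⟨0, 1, by simp, 1, Set.mem_iInter.2 hT.one_mem, mul_one 1⟩
  | mul x y _ _ hx hy =>
    obtain ⟨m, a, ha, s, hs, rfl⟩ := hx
    obtain ⟨k, b, hb, t, ht, rfl⟩ := hy
    refine ⟨m + k, a * b, by rw [pow_add]; exact Set.mul_mem_mul ha hb, b⁻¹ * s * b * t,
      hT.iInter_mul_mem (hT.iInter_conj_mem hb hs) ht, ?_⟩
    simp [mul_assoc]
  | inv x _ hx =>
    obtain ⟨m, a, ha, s, hs, rfl⟩ := hx
    have ha' : a⁻¹ ∈ A ^ m := by rw [← hAs.inv_pow]; simpa using ha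
    refine ⟨m, a⁻¹, ha', a⁻¹⁻¹ * s⁻¹ * a⁻¹, hT.iInter_conj_mem ha' (hT.iInter_inv_mem hs), ?_⟩
    simp [mul_assoc]

theorem iInter_conj_mem_of_mem_closure (hAs : IsSymmetricSubset A) {x t : G}
    (hx : x ∈ Subgroup.closure (A * ⋂ i, T i)) (ht : t ∈ ⋂ i, T i) :
    x⁻¹ * t * x ∈ ⋂ i, T i := by
  obtain ⟨m, a, ha, s, hs, rfl⟩ := hT.exists_mem_pow_mul hAs hx
  convert hT.iInter_mul_mem (hT.iInter_mul_mem (hT.iInter_inv_mem hs)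
    (hT.iInter_conj_mem ha ht)) hs using 1
  simp [mul_assoc]

theorem subset_closure : A ⊆ Subgroup.closure (A * ⋂ i, T i) := fun a ha =>
  Subgroup.subset_closure ⟨a, ha, 1, Set.mem_iInter.2 hT.one_mem, mul_one a⟩

theorem pow_subset_closure (m : ℕ) : A ^ m ⊆ Subgroup.closure (A * ⋂ i, T i) := by
  induction m with
  | zero => simp
  | succ m ih =>
    rw [pow_succ]
    rintro _ ⟨x, hx, a, ha, rfl⟩
    exact Subgroup.mul_mem _ (ih hx) (hT.subset_closure ha)

end IsThickeningSequence

/-- A definable symmetric set contained in a power of `A`, finitely many translates of which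
cover `A`. -/
structure IsGenericPiece (𝒜 : Set (Set G)) (A X : Set G) : Prop where
  mem : X ∈ 𝒜
  symmetric : IsSymmetricSubset X
  generic : ∃ F : Set G, F.Finite ∧ A ⊆ F * X
  subset_pow : ∃ d, X ⊆ A ^ d

variable {μ : ℕ → Set G → ℝ≥0∞} (h𝒜 : IsRecurrenceAlgebra 𝒜) (hAs : IsSymmetricSubset A)
  (hT : IsThickeningSequence 𝒜 A T) (hμ : IsRoughAmenabilityWitness 𝒜 A T μ)
  (hA : A ∈ 𝒜)
  (hfin : ∀ m : ℕ, ∃ i₀ : ℕ, ∀ i, i₀ < i → μ i (A ^ m) < ∞)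

include hAs hA in
theorem isGenericPiece_self : IsGenericPiece 𝒜 A A :=
  ⟨hA, hAs, ⟨1, Set.finite_one, by simp⟩, 1, by simp⟩

include h𝒜 hμ hA in
-- If X were null, so would be the finitely many translates covering A, but μ_i A = 1. Genericity
-- thus gives positivity for all μ_i at once, which matters because the measure changes during the
-- iteration.
theorem IsGenericPiece.measure_ne_zero {X : Set G} (hX : IsGenericPiece 𝒜 A X) (i : ℕ) :
    μ i X ≠ 0 := by
  intro h0
  have hempty : μ i ∅ = 0 := (hμ.rough i).measure_empty h𝒜 hA (by simp [hμ.normalised i])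
  obtain ⟨F, hF, hAF⟩ := hX.generic
  have key : F * X ∈ 𝒜 ∧ μ i (F * X) = 0 := by
    clear hAF
    induction F, hF using Set.Finite.induction_on with
    | empty => simpa using ⟨h𝒜.empty, hempty⟩
    | @insert a s _ _ ih =>
      have ha := h𝒜.smul a _ hX.mem
      rw [Set.insert_eq, Set.union_mul, Set.singleton_mul]
      refine ⟨h𝒜.union _ ha _ ih.1, ?_⟩
      have h := (hμ.rough i).union_le _ ha _ ih.1
      rw [hμ.left_invariant i a X hX.mem, h0, ih.2, add_zero] at h
      exact le_zero_iff.1 h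
  have := (hμ.rough i).mono _ hA _ key.1 hAF
  rw [hμ.normalised, key.2] at this
  simp at this

include h𝒜 hT hμ hA hfin

theorem IsGenericPiece.exists_pow_subset {X : Set G} (hX : IsGenericPiece 𝒜 A X) (j : ℕ) :
    ∃ S, IsGenericPiece 𝒜 A S ∧ S ^ 8 ⊆ X ^ 4 * T j := by
  obtain ⟨d, hd⟩ := hX.subset_pow
  obtain ⟨i₀, hi₀⟩ := hfin (d * (2 + 2 * 8))
  -- Room for eight thickening steps of cost d + 2, one product, a conjugation by A ^ (2d), and the
  -- requirement i > i₀.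
  obtain ⟨i, hi⟩ : ∃ i, i = j + 8 * (d + 2) + 1 + 2 * d + i₀ + 1 := ⟨_, rfl⟩
  have hfin' : μ i (X ^ (2 + 2 * 8)) ≠ ∞ := by
    refine ne_top_of_le_ne_top (hi₀ i (by omega)).ne
      ((hμ.rough i).mono _ (h𝒜.pow hX.mem _) _ (h𝒜.pow hA _) ?_)
    rw [pow_mul]
    exact Set.pow_subset_pow_left hd
  obtain ⟨S, hS, hSs, hSX, ⟨F, hF, hXF⟩, hS8⟩ := exists_generic_pow_subset
    -- Moving W past X ⊆ A ^ d costs d indices, and the two multiplications cost one each.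
    (V := fun l => T (i - (d + 2) * l)) h𝒜 (hμ.rough i) (hμ.left_invariant i) (hT.definable i)
    (hT.one_mem i) hX.mem hX.symmetric (p := 8) (fun l => hT.definable _) (hT.one_mem _) (by
      intro l hl
      rintro _ ⟨_, ⟨t, ht, _, ⟨x, hx, v, hv, rfl⟩, rfl⟩, w, hw, rfl⟩
      have hil : (d + 2) * l + (d + 2) = (d + 2) * (l + 1) := by ring
      have hile : (d + 2) * (l + 1) ≤ (d + 2) * 8 := by gcongr; omega
      refine ⟨x, hx, x⁻¹ * t * x * (v * w), ?_, by simp [mul_assoc]⟩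
      have h1 : x⁻¹ * t * x ∈ T (i - d) := hT.conj_mem (hd hx) (by rwa [Nat.sub_add_cancel (by omega)])
      have h2 : v * w ∈ T (i - (d + 2) * l - 1) :=
        hT.mul_mem (by rwa [Nat.sub_add_cancel (by omega)]) (hT.antitone (by omega) hw)
      exact hT.mul_mem (hT.antitone (by omega) h1) (hT.antitone (by omega) h2))
    hfin' (hX.measure_ne_zero h𝒜 hμ hA i)
  refine ⟨S, ⟨hS, hSs, ?_, 2 * d, hSX.trans ?_⟩, ?_⟩
  · obtain ⟨F', hF', hAF⟩ := hX.generic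
    refine ⟨F' * F, hF'.mul hF, hAF.trans ?_⟩
    rw [mul_assoc]
    gcongr
  · rw [mul_comm, pow_mul]
    exact Set.pow_subset_pow_left hd
  · rintro g hg
    obtain ⟨_, ⟨x, hx, v, hv, rfl⟩, _, ⟨v', hv', y, hy, rfl⟩, rfl⟩ := hS8 hg
    have hv' : v' ∈ T (i - (d + 2) * 8) := by simpa using hT.inv_mem hv'
    have hy' : y ∈ A ^ (d * 2) := by
      rw [pow_mul]
      exact Set.pow_subset_pow_left hd hy
    refine ⟨x * y, ?_, y⁻¹ * (v * v') * y, hT.conj_mem hy' (hT.mul_mem ?_ ?_), ?_⟩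
    · rw [show 4 = 2 + 2 from rfl, pow_add]; exact Set.mul_mem_mul hx hy
    · exact hT.antitone (by omega) hv
    · exact hT.antitone (by omega) hv'
    · simp [mul_assoc]

/-- The exponent 8 = 4 + 4 is what makes this work: for large k' the product lies in S⁸ T_{k+1} ⊆ X⁴
T_{k+1} T_{k+1} ⊆ X⁴ T_k. -/
theorem IsGenericPiece.exists_refinement {X : Set G} (hX : IsGenericPiece 𝒜 A X) (k : ℕ) :
    ∃ X' k', IsGenericPiece 𝒜 A X' ∧ (X' ^ 4 * T k') * (X' ^ 4 * T k') ⊆ X ^ 4 * T k ∧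
      (X' ^ 4 * T k')⁻¹ ⊆ X ^ 4 * T k := by
  obtain ⟨S, hS, hS8⟩ := hX.exists_pow_subset h𝒜 hT hμ hA hfin (k + 1)
  obtain ⟨d, hd⟩ := hS.subset_pow
  have hconj : ∀ x ∈ S ^ 4, ∀ t ∈ T (k + 2 + d * 4), x⁻¹ * t * x ∈ T (k + 2) := by
    intro x hx t ht
    refine hT.conj_mem ?_ ht
    rw [pow_mul]
    exact Set.pow_subset_pow_left hd hx
  have hmem : ∀ x ∈ S ^ 8, ∀ t ∈ T (k + 1), x * t ∈ X ^ 4 * T k := by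
    intro x hx t ht
    obtain ⟨y, hy, s, hs, rfl⟩ := hS8 hx
    exact ⟨y, hy, s * t, hT.mul_mem hs ht, by simp [mul_assoc]⟩
  refine ⟨S, k + 2 + d * 4, hS, ?_, ?_⟩
  · rintro _ ⟨_, ⟨x, hx, t, ht, rfl⟩, _, ⟨y, hy, s, hs, rfl⟩, rfl⟩
    convert hmem (x * y) ?_ (y⁻¹ * t * y * s) (hT.mul_mem (hconj y hy t ht)
      (hT.antitone (by omega) hs)) using 1
    · simp [mul_assoc]
    · rw [show 8 = 4 + 4 from rfl, pow_add]; exact Set.mul_mem_mul hx hy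
  · intro g hg
    obtain ⟨x, hx, t, ht, hxt⟩ := Set.mem_inv.1 hg
    have hx' : x⁻¹ ∈ S ^ 4 := by rw [← hS.symmetric.inv_pow]; simpa using hx
    convert hmem x⁻¹ (hS.symmetric.pow_mono (by norm_num) hx') (x⁻¹⁻¹ * t⁻¹ * x⁻¹)
      (hT.antitone (by omega) (hconj x⁻¹ hx' t⁻¹ (hT.inv_mem ht))) using 1
    rw [← inv_inj, ← hxt]
    simp [mul_assoc]

/-- Translates of X by A^m stay in A ^ (m + d), of finite measure, so packing yields a finite cover
by translates of X T_i X⁻¹; conjugation turns this into X² T_k. -/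
theorem IsGenericPiece.exists_cover {X : Set G} (hX : IsGenericPiece 𝒜 A X) (k m : ℕ) :
    ∃ F : Set G, F.Finite ∧ F ⊆ A ^ m ∧ A ^ m ⊆ F * (X ^ 4 * T k) := by
  obtain ⟨d, hd⟩ := hX.subset_pow
  obtain ⟨i₀, hi₀⟩ := hfin (m + d)
  obtain ⟨F, hF, hFA, hcov⟩ := exists_finite_cover (W := T (k + i₀ + 1 + d)) h𝒜 (hμ.rough _)
    (hμ.left_invariant _) (hT.definable _) (hT.symmetric _).2 hX.mem hX.symmetric.1 (hT.one_mem _)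
    (hX.measure_ne_zero h𝒜 hμ hA _) (Y := A ^ m) (h𝒜.pow hA (m + d)) (hi₀ _ (by omega)).ne
    (by rw [pow_add]; gcongr)
  refine ⟨F, hF, hFA, hcov.trans (Set.mul_subset_mul_left ?_)⟩
  rintro _ ⟨_, ⟨x, hx, t, ht, rfl⟩, y, hy, rfl⟩
  rw [← hX.symmetric.2] at hy
  refine ⟨x * y, hX.symmetric.pow_mono (show 2 ≤ 4 by norm_num) ?_, y⁻¹ * t * y,
    hT.antitone (by omega) (hT.conj_mem (hd hy) ht), by simp [mul_assoc]⟩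
  rw [pow_two]
  exact Set.mul_mem_mul hx hy

end Thickening

/-! ### Chains of neighbourhoods and their normal cores -/

section Chain

variable {G : Type w} [Group G]

/-- A decreasing sequence of sets whose intersection is a subgroup. -/
structure IsSubgroupChain (E : ℕ → Set G) : Prop where
  one_mem : ∀ n, (1 : G) ∈ E n
  mul_subset : ∀ n, E (n + 1) * E (n + 1) ⊆ E n
  inv_subset : ∀ n, (E (n + 1))⁻¹ ⊆ E n

namespace IsSubgroupChain

variable {E : ℕ → Set G} (hE : IsSubgroupChain E)
include hE

theorem mul_mem {n : ℕ} {x y : G} (hx : x ∈ E (n + 1)) (hy : y ∈ E (n + 1)) : x * y ∈ E n :=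
  hE.mul_subset n (Set.mul_mem_mul hx hy)

theorem inv_mem {n : ℕ} {x : G} (hx : x ∈ E (n + 1)) : x⁻¹ ∈ E n :=
  hE.inv_subset n (by simpa using hx)

theorem antitone : Antitone E :=
  antitone_nat_of_succ_le fun n x hx => by simpa using hE.mul_mem hx (hE.one_mem (n + 1))

/-- The largest subgroup of the intersection of a chain that is normalised by `Γ`. -/
def core (Γ : Subgroup G) : Subgroup G where
  carrier := {x | ∀ γ ∈ Γ, ∀ n, γ⁻¹ * x * γ ∈ E n}
  one_mem' := fun γ _ n => by simpa using hE.one_mem n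
  mul_mem' := fun {x y} hx hy γ hγ n => by
    convert hE.mul_mem (hx γ hγ (n + 1)) (hy γ hγ (n + 1)) using 1
    group
  inv_mem' := fun {x} hx γ hγ n => by
    convert hE.inv_mem (hx γ hγ (n + 1)) using 1
    group

variable {Γ : Subgroup G}

theorem conj_mem_core {γ x : G} (hγ : γ ∈ Γ) (hx : x ∈ hE.core Γ) :
    γ * x * γ⁻¹ ∈ hE.core Γ := fun δ hδ n => by
  convert hx (γ⁻¹ * δ) (Subgroup.mul_mem _ (Subgroup.inv_mem _ hγ) hδ) n using 1
  group

variable {D : ℕ → G} (hD : ∀ i, D i ∈ Γ) (hcov : ∀ n, ∀ x ∈ Γ, ∃ i, x ∈ D i • E n)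
include hD hcov

/-- Writing γ = D_i e with e deep in the chain, conjugation by e costs only a few levels. Hence the
core is a countable intersection. -/
theorem mem_core_iff {x : G} : x ∈ hE.core Γ ↔ ∀ i n, (D i)⁻¹ * x * D i ∈ E n := by
  refine ⟨fun hx i n => hx _ (hD i) n, fun hx γ hγ n => ?_⟩
  obtain ⟨i, e, he, rfl⟩ := hcov (n + 3) γ hγ
  have h1 := hE.mul_mem (hE.mul_mem (hE.inv_mem he) (hx i (n + 2)))
    (hE.antitone (show n + 1 ≤ n + 3 by omega) he)
  convert h1 using 1
  simp [mul_assoc]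

/-- Countably many translates of each member of the chain cover `Γ`, hence the core has index at
most the cardinality of the continuum. -/
theorem exists_code : ∃ c : G → ℕ → ℕ, ∀ x ∈ Γ, ∀ y ∈ Γ, c x = c y → x⁻¹ * y ∈ hE.core Γ := by
  choose! f hf using hcov
  refine ⟨fun x p => f p.unpair.2 (x * D p.unpair.1), fun x hx y hy hxy => ?_⟩
  -- If x D_i and y D_i lie in the same translate of E (n + 2), then D_i⁻¹ x⁻¹ y D_i lies in E n.
  refine (hE.mem_core_iff hD (fun n x hx => ⟨_, hf n x hx⟩)).2 fun i n => ?_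
  have h : f (n + 2) (x * D i) = f (n + 2) (y * D i) := by
    simpa using congrFun hxy (Nat.pair i (n + 2))
  obtain ⟨a, ha, hxa⟩ := hf (n + 2) (x * D i) (Subgroup.mul_mem _ hx (hD i))
  obtain ⟨b, hb, hyb⟩ := hf (n + 2) (y * D i) (Subgroup.mul_mem _ hy (hD i))
  convert hE.mul_mem (hE.inv_mem ha) (hE.antitone (Nat.le_succ _) hb) using 1
  simp only [smul_eq_mul] at hxa hyb
  rw [← h] at hyb
  rw [← inv_mul_eq_iff_eq_mul.2 hxa.symm, ← inv_mul_eq_iff_eq_mul.2 hyb.symm]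
  group

end IsSubgroupChain

end Chain

/-! ### Construction of the normal subgroup -/

section Main

variable {G : Type w} [Group G] {𝒜 : Set (Set G)} {A : Set G} {T : ℕ → Set G}
  {μ : ℕ → Set G → ℝ≥0∞} (h𝒜 : IsRecurrenceAlgebra 𝒜) (hAs : IsSymmetricSubset A)
  (hT : IsThickeningSequence 𝒜 A T) (hμ : IsRoughAmenabilityWitness 𝒜 A T μ)
  (hA : A ∈ 𝒜)
  (hfin : ∀ m : ℕ, ∃ i₀ : ℕ, ∀ i, i₀ < i → μ i (A ^ m) < ∞)
include h𝒜 hAs hT hμ hA hfin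

theorem exists_subgroupChain (k : ℕ) : ∃ E : ℕ → Set G, IsSubgroupChain E ∧ E 0 = A ^ 4 * T k ∧
    (∀ n, E n ∈ 𝒜) ∧ (∀ n, ⋂ i, T i ⊆ E n) ∧
    ∀ n m, ∃ F : Set G, F.Finite ∧ F ⊆ A ^ m ∧ A ^ m ⊆ F * E n := by
  choose! X' k' hX' hmul hinv using fun (X : Set G) (k : ℕ) (hX : IsGenericPiece 𝒜 A X) =>
    hX.exists_refinement h𝒜 hT hμ hA hfin k
  let s : ℕ → Set G × ℕ := fun n => (fun p => (X' p.1 p.2, k' p.1 p.2))^[n] (A, k)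
  have hs : ∀ n, s (n + 1) = (X' (s n).1 (s n).2, k' (s n).1 (s n).2) := fun n =>
    Function.iterate_succ_apply' _ n _
  have hgen : ∀ n, IsGenericPiece 𝒜 A (s n).1 := by
    intro n
    induction n with
    | zero => exact isGenericPiece_self hAs hA
    | succ n ih => rw [hs]; exact hX' _ _ ih
  refine ⟨fun n => (s n).1 ^ 4 * T (s n).2, ⟨fun n => ?_, fun n => ?_, fun n => ?_⟩, rfl,
    fun n => ?_, fun n t ht => ?_, fun n m => ?_⟩
  · exact ⟨1, Set.one_mem_pow (hgen n).symmetric.1, 1, hT.one_mem _, mul_one 1⟩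
  · rw [hs]; exact hmul _ _ (hgen n)
  · rw [hs]; exact hinv _ _ (hgen n)
  · exact h𝒜.mul _ (h𝒜.pow (hgen n).mem 4) _ (hT.definable _)
  · exact ⟨1, Set.one_mem_pow (hgen n).symmetric.1, t, Set.mem_iInter.1 ht _, one_mul t⟩
  · exact (hgen n).exists_cover h𝒜 hT hμ hA hfin _ m

theorem exists_normalized_subgroup (k : ℕ) : ∃ N : Subgroup G,
    (∀ γ ∈ Subgroup.closure (A * ⋂ i, T i), ∀ x ∈ N, γ * x * γ⁻¹ ∈ N) ∧
    (∃ F : Set (Set G), F.Countable ∧ F ⊆ 𝒜 ∧ (N : Set G) = ⋂₀ F) ∧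
    (∃ c : G → ℕ → ℕ, ∀ x ∈ Subgroup.closure (A * ⋂ i, T i),
      ∀ y ∈ Subgroup.closure (A * ⋂ i, T i), c x = c y → x⁻¹ * y ∈ N) ∧
    (⋂ i, T i) ⊆ (N : Set G) ∧ (N : Set G) ⊆ A ^ 4 * T k := by
  obtain ⟨E, hE, hE0, hE𝒜, hTE, hcov⟩ := exists_subgroupChain h𝒜 hAs hT hμ hA hfin k
  choose F hF hFA hFcov using hcov
  have hcount : (⋃ n, ⋃ m, F n m).Countable :=
    Set.countable_iUnion fun n => Set.countable_iUnion fun m => (hF n m).countable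
  have hne : (⋃ n, ⋃ m, F n m).Nonempty := by
    obtain ⟨f, hf, -⟩ := hFcov 0 0 (by simp : (1 : G) ∈ A ^ 0)
    exact ⟨f, Set.mem_iUnion₂.2 ⟨0, 0, hf⟩⟩
  obtain ⟨D, hDeq⟩ := hcount.exists_eq_range hne
  set Γ := Subgroup.closure (A * ⋂ i, T i) with hΓ
  have hD : ∀ i, D i ∈ Γ := by
    intro i
    have : D i ∈ ⋃ n, ⋃ m, F n m := hDeq ▸ Set.mem_range_self i
    obtain ⟨n, m, h⟩ := Set.mem_iUnion₂.1 this
    exact hT.pow_subset_closure m (hFA n m h)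
  have hDcov : ∀ n, ∀ x ∈ Γ, ∃ i, x ∈ D i • E n := by
    intro n x hx
    obtain ⟨m, a, ha, t, ht, rfl⟩ := hT.exists_mem_pow_mul hAs hx
    -- One level deeper than required, so that the factor t ∈ T_∞ can be absorbed.
    obtain ⟨f, hf, e, he, rfl⟩ := hFcov (n + 1) m ha
    have : f ∈ ⋃ n, ⋃ m, F n m := Set.mem_iUnion₂.2 ⟨n + 1, m, hf⟩
    rw [hDeq] at this
    obtain ⟨i, rfl⟩ := this
    exact ⟨i, e * t, hE.mul_mem he (hTE _ ht), by simp [mul_assoc]⟩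
  refine ⟨hE.core Γ, fun γ hγ x hx => hE.conj_mem_core hγ hx,
    ⟨Set.range fun p : ℕ × ℕ => {x | (D p.1)⁻¹ * x * D p.1 ∈ E p.2}, Set.countable_range _, ?_, ?_⟩,
    hE.exists_code hD hDcov, ?_, ?_⟩
  · rintro _ ⟨p, rfl⟩
    exact h𝒜.conj _ _ (hE𝒜 _)
  · ext x
    rw [SetLike.mem_coe, hE.mem_core_iff hD hDcov]
    simp
  · exact fun t ht γ hγ n => hTE n (hT.iInter_conj_mem_of_mem_closure hAs hγ ht)
  · intro x hx
    rw [← hE0]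
    simpa using hx 1 (one_mem Γ) 0

theorem exists_normalized_subgroup_of_saturated
    (hsat : ∀ X : ℕ → Set G, (∀ k, X k ∈ 𝒜) → Antitone X → (∀ k, (X k).Nonempty) →
      (⋂ k, X k).Nonempty) : ∃ N : Subgroup G,
    (∀ γ ∈ Subgroup.closure (A * ⋂ i, T i), ∀ x ∈ N, γ * x * γ⁻¹ ∈ N) ∧
    (∃ F : Set (Set G), F.Countable ∧ F ⊆ 𝒜 ∧ (N : Set G) = ⋂₀ F) ∧
    (∃ c : G → ℕ → ℕ, ∀ x ∈ Subgroup.closure (A * ⋂ i, T i),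
      ∀ y ∈ Subgroup.closure (A * ⋂ i, T i), c x = c y → x⁻¹ * y ∈ N) ∧
    (⋂ i, T i) ⊆ (N : Set G) ∧ (N : Set G) ⊆ A ^ 4 * ⋂ i, T i := by
  choose N hconj hF hc hTN hNA using exists_normalized_subgroup h𝒜 hAs hT hμ hA hfin
  choose F hFc hF𝒜 hNF using hF
  choose c hc using hc
  refine ⟨⨅ k, N k, ?_, ⟨⋃ k, F k, Set.countable_iUnion hFc, Set.iUnion_subset hF𝒜, ?_⟩,
    ⟨fun x p => c p.unpair.1 x p.unpair.2, ?_⟩, ?_, ?_⟩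
  · intro γ hγ x hx
    rw [Subgroup.mem_iInf] at hx ⊢
    exact fun k => hconj k γ hγ x (hx k)
  · rw [Subgroup.coe_iInf, Set.sInter_iUnion]
    exact Set.iInter_congr hNF
  · intro x hx y hy hxy
    rw [Subgroup.mem_iInf]
    refine fun k => hc k x hx y hy (funext fun n => ?_)
    simpa using congrFun hxy (Nat.pair k n)
  · intro t ht
    rw [Subgroup.coe_iInf]
    exact Set.mem_iInter.2 fun k => hTN k ht
  · intro x hx
    have hx : ∀ k, x ∈ A ^ 4 * T k := fun k => hNA k (by
      rw [SetLike.mem_coe, Subgroup.mem_iInf] at hx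
      exact hx k)
    -- For each k there is some a ∈ A⁴ with a⁻¹ x ∈ T_k; saturation gives one a for all k.
    obtain ⟨a, ha⟩ := hsat (fun k => A ^ 4 ∩ x • T k)
      (fun k => h𝒜.inter _ (h𝒜.pow hA 4) _ (h𝒜.smul x _ (hT.definable k)))
      (fun i j hij => by have := hT.antitone hij; dsimp only; gcongr)
      (fun k => by
        obtain ⟨a, ha, t, ht, hat⟩ := hx k
        refine ⟨a, ha, t⁻¹, hT.inv_mem ht, ?_⟩
        simp [← hat])
    rw [Set.mem_iInter] at ha
    refine ⟨a, (ha 0).1, a⁻¹ * x, Set.mem_iInter.2 fun k => ?_, by simp⟩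
    obtain ⟨t, ht, hat⟩ := (ha k).2
    convert hT.inv_mem ht using 1
    simp [← hat]

end Main

theorem mainTheorem1 (L : MSLanguage.{u, v, v'}) (M : L.Sorts → Type w) [L.Structure M]
    (κ : Cardinal.{max u w}) (hκ : 2 ^ ℵ₀ < κ) (hM : L.IsSaturated M κ)
    {n : ℕ} {σ : Fin n → L.Sorts} (G : Set (∀ i, M (σ i))) [Group G]
    (hG : L.IsDefinableGroup G)
    (A : Set G) (hA : A ∈ L.definableSubsets G) (hAsymm : IsSymmetricSubset A)
    (T : ℕ → Set G) (hT : IsThickeningSequence (L.definableSubsets G) A T)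
    (μ : ℕ → Set G → ℝ≥0∞)
    (hμ : IsRoughAmenabilityWitness (L.definableSubsets G) A T μ)
    (hfin : ∀ m : ℕ, ∃ i₀ : ℕ, ∀ i, i₀ < i → μ i (A ^ m) < ∞) :
    ∃ N : Subgroup G,
      N ≤ Subgroup.closure (A * ⋂ i, T i) ∧
      (N.subgroupOf (Subgroup.closure (A * ⋂ i, T i))).Normal ∧
      L.IsTypeDefinable κ (N : Set G) ∧
      Cardinal.lift.{u} #(Subgroup.closure (A * ⋂ i, T i) ⧸
        N.subgroupOf (Subgroup.closure (A * ⋂ i, T i))) < κ ∧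
      (⋂ i, T i) ⊆ (N : Set G) ∧
      (N : Set G) ⊆ A ^ 4 * ⋂ i, T i := by 
  have h𝒜 := MSLanguage.isRecurrenceAlgebra_definableSubsets hG
  have hℵκ : ℵ₀ < κ := (Cardinal.cantor ℵ₀).trans hκ
  obtain ⟨N, hconj, ⟨F, hFc, hF, hNF⟩, ⟨c, hc⟩, hTN, hNA⟩ :=
    exists_normalized_subgroup_of_saturated h𝒜 hAsymm hT hμ hA hfin (by
      intro X hX hanti hne
      obtain ⟨x, hx⟩ := hM.nonempty_iInter hℵκ (X := fun k => Subtype.val '' X k) hX (by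
        intro k
        obtain ⟨x, hx⟩ := hne k
        exact ⟨x, Set.mem_iInter₂.2 fun j hj => ⟨x, hanti hj hx, rfl⟩⟩)
      rw [Set.mem_iInter] at hx
      obtain ⟨y, -, hy⟩ := hx 0
      refine ⟨y, Set.mem_iInter.2 fun k => ?_⟩
      obtain ⟨z, hz, hzx⟩ := hx k
      rwa [← Subtype.ext (hzx.trans hy.symm)])
  set Γ := Subgroup.closure (A * ⋂ i, T i) with hΓ
  refine ⟨N, ?_, ⟨?_⟩, ⟨F, hF, ?_, hNF⟩, ?_, hTN, hNA⟩
  · intro x hx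
    obtain ⟨a, ha, t, ht, rfl⟩ := hNA hx
    refine Subgroup.mul_mem _ (hT.pow_subset_closure 4 ha) (Subgroup.subset_closure ?_)
    exact ⟨1, hAsymm.1, t, ht, one_mul t⟩
  · intro x hx γ
    rw [Subgroup.mem_subgroupOf] at hx ⊢
    exact hconj γ γ.2 x hx
  · refine lt_of_le_of_lt ?_ hℵκ
    rw [Cardinal.lift_le_aleph0]
    exact hFc.le_aleph0
  · refine lt_of_le_of_lt ?_ hκ
    -- Coset representatives with equal codes are equal modulo N, so the index is at most the number
    -- of sequences of naturals.
    have hinj : Function.Injective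
        fun q : Γ ⧸ N.subgroupOf Γ => ULift.up.{w} (c (q.out : Γ)) := by
      intro p q hpq
      have h := hc _ p.out.2 _ q.out.2 (ULift.up_injective hpq)
      rw [← QuotientGroup.out_eq' p, ← QuotientGroup.out_eq' q, QuotientGroup.eq,
        Subgroup.mem_subgroupOf]
      exact h
    have h1 := Cardinal.mk_le_of_injective hinj
    have h2 : #(ULift.{w} (ℕ → ℕ)) = 2 ^ ℵ₀ := by simp
    rw [h2] at h1
    have h3 := Cardinal.lift_le.{u}.2 h1
    simpa using h3
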